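/- Let $k \ge 2$. A hypergraph $(H,E)$, $E \subseteq H^k$, is \emph{$k$-full} if $E$ is closed under permutation on $k$-tuples of distinct vertices and contains every $k$-tuple with fewer than $k$ distinct entries. A \emph{template} of arity $k$ is a sequence $\mathcal H = \langle (H_n,E_n) : n<\omega\rangle$ of finite $k$-full hypergraphs, with vertex sets $H_n=\{0,\dots,|H_n|-1\}$, for which there is $f:\omega\to\omega\setminus\{0\}$ with $f(n)\to\infty$ and $f(n)\le |H_n|$ for all $n$, such that for every $n$ and any $f(n)$ many $(k-1)$-tuples $\bar i^{\,0},\dots,\bar i^{\,f(n)-1}$ from $H_n$ there is $s\in H_n$ with $\langle s\rangle^\smallfrown \bar i^{\,\ell}\in E_n$ for all $\ell<f(n)$. Let $X$ be the set of finite sequences $\eta$ with $\eta(n)\in H_n$ for all $n<\mathrm{lgn}(\eta)$. Let $T_0$ be the universal theory, in the language with equality, a $k$-place relation $R$ and unary predicates $Q_\eta$ ($\eta\in X$), stating that: $R$ is symmetric and holds only on $k$-tuples of distinct elements; $Q_{\langle\rangle}$ holds everywhere; $Q_\nu$ implies $Q_\eta$ when $\eta$ is an initial segment of $\nu$; the predicates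 $Q_{\eta^\smallfrown\langle i\rangle}$, $i \in H_{\mathrm{lgn}(\eta)}$, partition $Q_\eta$; and, whenever $\eta_0,\dots,\eta_{k-1}\in X$ have length $>n$ and $\langle\eta_0(n),\dots,\eta_{k-1}(n)\rangle\notin E_n$, no $R$-edge $(x_0,\dots,x_{k-1})$ satisfies $Q_{\eta_0}(x_0)\wedge\dots\wedge Q_{\eta_{k-1}}(x_{k-1})$. Then for every template $\mathcal H$ the theory $T_0$ has a model completion, and any model completion $T$ of $T_0$ is simple of rank $1$: (a) $T$ is simple, i.e. no formula $\varphi(\bar x,\bar y)$ has the tree property in a model of $T$; (b) $T$ has rank $1$, i.e. $1$ is the supremum of the $SU$-ranks of types in one variable over sets of parameters in models of $T$. Moreover, the only source of dividing is equality: let $M\models T$ and let $\varphi(\bar x,\bar y)$ be a formula. (c) If $\langle \bar a_i : i\in I\rangle$ is an indiscernible sequence in $M$ indexed by an infinite linear order and, for some $i_0$, $\varphi(\bar x,\bar a_{i_0})$ has a realization in $M$ none of whose entries is an entry of $\bar a_{i_0}$, then $\{\varphi(\bar x,\bar a_i): i\in I\}$ is consistent (finitely satisfiable in $M$). (d) If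 $\bar a$ is a tuple of $M$ and $\varphi(\bar x,\bar a)$ has a realization in $M$ none of whose entries is an entry of $\bar a$, then $\varphi(\bar x,\bar a)$ does not divide over any $A\subseteq M$. -/

import Mathlib

open FirstOrder FirstOrder.Language

/-! ### Model-theoretic notions -/

namespace ModelNotions

universe u v w

/-- `T'` is a model completion of `T`: it extends `T`, every model of `T` embeds into a model of
`T'`, and for every model `M` of `T` the theory `T'` together with the atomic diagram of `M` is
complete, i.e. any two models of `T'` into which `M` embeds satisfy the same first-order
formulas about the elements of `M`.  (Models are nonempty.) -/
structure IsModelCompletion {L : FirstOrder.Language.{u, v}} (T T' : L.Theory) : Prop where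
  extends_base : ∀ φ ∈ T, T' ⊨ᵇ φ
  embeds : ∀ M : Theory.ModelType.{u, v, max u v} T,
    ∃ N : Theory.ModelType.{u, v, max u v} T', Nonempty (M ↪[L] N)
  diagram_complete : ∀ (M : Theory.ModelType.{u, v, max u v} T)
    (N₁ N₂ : Theory.ModelType.{u, v, max u v} T') (f₁ : M ↪[L] N₁) (f₂ : M ↪[L] N₂)
    (φ : L.Formula M), φ.Realize f₁ ↔ φ.Realize f₂

section

variable {L : FirstOrder.Language.{u, v}}

/-- The tuples `s`, `t` of `M` have the same complete type over `A ⊆ M`. -/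
def SameTypeOver {M : Type w} [L.Structure M] {n : ℕ} (A : Set M) (s t : Fin n → M) : Prop :=
  ∀ φ : L.Formula (A ⊕ Fin n),
    φ.Realize (Sum.elim (fun c : A => (c : M)) s) ↔ φ.Realize (Sum.elim (fun c : A => (c : M)) t)

/-- The instance `φ(x̄, ā)` divides over `A`: for some `r` there are, in an elementary extension,
realizations `s 0, s 1, …` of `tp(ā/A)` such that `{φ(x̄, s i) : i < ω}` is `r`-inconsistent. -/
def Divides {M : Type w} [L.Structure M] {m n : ℕ} (A : Set M)
    (φ : L.Formula (Fin m ⊕ Fin n)) (a : Fin n → M) : Prop :=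
  ∃ (N : Type w) (_ : L.Structure N) (f : M ↪ₑ[L] N) (r : ℕ) (s : ℕ → Fin n → N),
    (∀ i, SameTypeOver (L := L) (f '' A) (s i) (f ∘ a)) ∧
    ∀ S : Finset ℕ, S.card = r →
      ¬ ∃ b : Fin m → N, ∀ i ∈ S, φ.Realize (Sum.elim b (s i))

/-- The instance `φ(x̄, ā)` forks over `A`: in an elementary extension it implies a finite
disjunction of instances of formulas each of which divides over `A`. -/
def Forks {M : Type w} [L.Structure M] {m n : ℕ} (A : Set M)
    (φ : L.Formula (Fin m ⊕ Fin n)) (a : Fin n → M) : Prop :=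
  ∃ (N : Type w) (_ : L.Structure N) (f : M ↪ₑ[L] N) (l : ℕ) (p : Fin l → ℕ)
    (ψ : ∀ i : Fin l, L.Formula (Fin m ⊕ Fin (p i))) (c : ∀ i : Fin l, Fin (p i) → N),
    (∀ i, Divides (f '' A) (ψ i) (c i)) ∧
    ∀ b : Fin m → N, φ.Realize (Sum.elim b (f ∘ a)) → ∃ i, (ψ i).Realize (Sum.elim b (c i))

/-- `tp(b/B)` forks over `A`: it contains an instance which forks over `A`. -/
def TypeForks (L : FirstOrder.Language.{u, v}) {M : Type w} [L.Structure M] {m : ℕ} (A B : Set M)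
    (b : Fin m → M) : Prop :=
  ∃ (n : ℕ) (φ : L.Formula (Fin m ⊕ Fin n)) (a : Fin n → M),
    (∀ i, a i ∈ B) ∧ φ.Realize (Sum.elim b a) ∧ Forks A φ a

/-- `SU(tp(b/A)) ≥ n`: always for `n = 0`; and `SU(tp(b/A)) ≥ n + 1` if, in some elementary
extension, `tp(b/A)` has a forking extension `tp(b/B)`, `A ⊆ B`, with `SU(tp(b/B)) ≥ n`. -/
def SURankGE (L : FirstOrder.Language.{u, v}) {m : ℕ} :
    ℕ → ∀ (M : Type w) [L.Structure M], Set M → (Fin m → M) → Prop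
  | 0, _, _, _, _ => True
  | n + 1, M, _, A, b =>
    ∃ (N : Type w) (_ : L.Structure N) (f : M ↪ₑ[L] N) (B : Set N),
      f '' A ⊆ B ∧ TypeForks L (f '' A) B (f ∘ b) ∧ SURankGE L n N B (f ∘ b)

/-- The theory `T` has (SU-)rank `1`: the supremum of the SU-ranks of types in one variable over
sets of parameters in models of `T` is `1`. -/
def HasRankOne (T : L.Theory) : Prop :=
  (∃ (M : Theory.ModelType.{u, v, max u v} T) (A : Set M) (b : Fin 1 → M), SURankGE L 1 M A b) ∧
  ∀ (M : Theory.ModelType.{u, v, max u v} T) (A : Set M) (b : Fin 1 → M), ¬ SURankGE L 2 M A b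

/-- `φ(x̄, ȳ)` has the tree property in `M`: for some `r` there are parameters `a η`,
`η ∈ ω^{<ω}`, such that along each branch the instances are consistent (finitely satisfiable),
while the instances at the immediate successors of each node are `r`-inconsistent. -/
def HasTreeProperty (M : Type w) [L.Structure M] {m n : ℕ}
    (φ : L.Formula (Fin m ⊕ Fin n)) : Prop :=
  ∃ (r : ℕ) (a : List ℕ → Fin n → M),
    (∀ (σ : ℕ → ℕ) (S : Finset ℕ), ∃ b : Fin m → M,
      ∀ i ∈ S, φ.Realize (Sum.elim b (a (List.ofFn fun j : Fin i => σ j)))) ∧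
    ∀ (η : List ℕ) (S : Finset ℕ), S.card = r →
      ¬ ∃ b : Fin m → M, ∀ i ∈ S, φ.Realize (Sum.elim b (a (η ++ [i])))

/-- `T` is simple: no formula has the tree property in a model of `T`. -/
def IsSimpleTheory (T : L.Theory) : Prop :=
  ∀ (M : Theory.ModelType.{u, v, max u v} T) (m n : ℕ) (φ : L.Formula (Fin m ⊕ Fin n)),
    ¬ HasTreeProperty M φ

/-- The sequence `a` of `n`-tuples of `M`, indexed by a linear order, is indiscernible (over the
empty set). -/
def IsIndiscernible (L : FirstOrder.Language.{u, v}) {M : Type w} [L.Structure M] {I : Type*} [LinearOrder I]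
    {n : ℕ} (a : I → Fin n → M) : Prop :=
  ∀ (l : ℕ) (φ : L.Formula (Fin l × Fin n)) (i j : Fin l → I), StrictMono i → StrictMono j →
    (φ.Realize (fun p => a (i p.1) p.2) ↔ φ.Realize (fun p => a (j p.1) p.2))

end

end ModelNotions

/-! ### Templates and their theories -/

namespace HypergraphTemplate

/-- A `k`-full hypergraph: the edges on tuples of `k` distinct vertices form a symmetric
relation, and all tuples with fewer than `k` distinct entries are edges. -/
structure IsFull {k : ℕ} {V : Type*} (E : (Fin k → V) → Prop) : Prop where
  symm : ∀ v : Fin k → V, Function.Injective v → E v → ∀ σ : Equiv.Perm (Fin k), E (v ∘ σ)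
  of_not_injective : ∀ v : Fin k → V, ¬ Function.Injective v → E v

/-- A template of arity `k`: `k`-full hypergraphs `E n` on `{0, …, H n - 1}` and a function `f`.
In `extension`, the `(k-1)`-tuples are the `i ℓ`, with entries indexed by `1, …, k-1`; the tuple
`⟨s, i ℓ 1, …, i ℓ (k-1)⟩` is `w`. -/
structure Template (k : ℕ) where
  two_le : 2 ≤ k
  H : ℕ → ℕ
  E : ∀ n, (Fin k → Fin (H n)) → Prop
  f : ℕ → ℕ
  f_pos : ∀ n, 0 < f n
  f_tendsto : Filter.Tendsto f Filter.atTop Filter.atTop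
  full : ∀ n, IsFull (E n)
  f_le : ∀ n, f n ≤ H n
  extension : ∀ n (i : Fin (f n) → {j : Fin k // (j : ℕ) ≠ 0} → Fin (H n)),
    ∃ s : Fin (H n), ∀ ℓ : Fin (f n),
      E n (fun j => if h : (j : ℕ) ≠ 0 then i ℓ ⟨j, h⟩ else s)

variable {k : ℕ}

/-- The tree `X` of the template: finite sequences `η` with `η n < H n` for `n < lgn η`. -/
structure Node (𝓗 : Template k) where
  lgn : ℕ
  val : ∀ i : Fin lgn, Fin (𝓗.H i)

/-- The empty sequence. -/
def Node.root (𝓗 : Template k) : Node 𝓗 := ⟨0, fun i => i.elim0⟩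

/-- The sequence `η⌢⟨i⟩`. -/
def Node.append {𝓗 : Template k} (η : Node 𝓗) (i : Fin (𝓗.H η.lgn)) : Node 𝓗 :=
  ⟨η.lgn + 1, Fin.snoc (α := fun j : Fin (η.lgn + 1) => Fin (𝓗.H j)) η.val i⟩

/-- `η` is an initial segment of `ν`. -/
def Node.IsInitial {𝓗 : Template k} (η ν : Node 𝓗) : Prop :=
  ∃ h : η.lgn ≤ ν.lgn, ∀ i : Fin η.lgn, ν.val (Fin.castLE h i) = η.val i

/-- The relation symbols: a `k`-place `R` and unary predicates `Q η`. -/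
inductive Rel (𝓗 : Template k) : ℕ → Type
  | R : Rel 𝓗 k
  | Q (η : Node 𝓗) : Rel 𝓗 1

/-- The language of the template. -/
def lang (𝓗 : Template k) : FirstOrder.Language.{0, 0} := ⟨fun _ => Empty, Rel 𝓗⟩

/-- The symbol `R` in the language. -/
def symR (𝓗 : Template k) : (lang 𝓗).Relations k := Rel.R

/-- The symbol `Q_η` in the language. -/
def symQ {𝓗 : Template k} (η : Node 𝓗) : (lang 𝓗).Relations 1 := Rel.Q η

/-- The atomic formula `R(x_{t 0}, …, x_{t (k-1)})`. -/
def atomR (𝓗 : Template k) {n : ℕ} (t : Fin k → Fin n) : (lang 𝓗).BoundedFormula Empty n :=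
  (symR 𝓗).boundedFormula fun j => &(t j)

/-- The atomic formula `Q_η(x_j)`. -/
def atomQ {𝓗 : Template k} {n : ℕ} (η : Node 𝓗) (j : Fin n) :
    (lang 𝓗).BoundedFormula Empty n :=
  (symQ η).boundedFormula₁ (&j)

/-- The axioms of the universal theory `T₀` of the template. -/
inductive BaseAxiom (𝓗 : Template k) : (lang 𝓗).Sentence → Prop
  | irrefl (i j : Fin k) (h : i ≠ j) :
      BaseAxiom 𝓗 (atomR 𝓗 id ⟹ ∼((&i : (lang 𝓗).Term (Empty ⊕ Fin k)) =' &j)).alls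
  | symm (σ : Equiv.Perm (Fin k)) :
      BaseAxiom 𝓗 (atomR 𝓗 id ⟹ atomR 𝓗 σ).alls
  | root :
      BaseAxiom 𝓗 (atomQ (Node.root 𝓗) (0 : Fin 1)).alls
  | refine (η ν : Node 𝓗) (h : η.IsInitial ν) :
      BaseAxiom 𝓗 (atomQ ν (0 : Fin 1) ⟹ atomQ η (0 : Fin 1)).alls
  | disjoint (η : Node 𝓗) (i j : Fin (𝓗.H η.lgn)) (h : i ≠ j) :
      BaseAxiom 𝓗 (∼(atomQ (η.append i) (0 : Fin 1) ⊓ atomQ (η.append j) (0 : Fin 1))).alls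
  | cover (η : Node 𝓗) :
      BaseAxiom 𝓗 (atomQ η (0 : Fin 1) ⟹
        BoundedFormula.iSup fun i => atomQ (η.append i) (0 : Fin 1)).alls
  | edge (η : Fin k → Node 𝓗) (n : ℕ) (hn : ∀ j, n < (η j).lgn)
      (h : ¬ 𝓗.E n (fun j => (η j).val ⟨n, hn j⟩)) :
      BaseAxiom 𝓗 ((BoundedFormula.iInf fun j => atomQ (η j) j) ⟹ ∼(atomR 𝓗 id)).alls

/-- The universal theory `T₀` of the template. -/
def baseTheory (𝓗 : Template k) : (lang 𝓗).Theory := {φ | BaseAxiom 𝓗 φ}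

end HypergraphTemplate

/-!
Adjoin a vertex to finitely many given ones, with prescribed edges and a prescribed initial segment
of its branch. Only the levels below some `L` can obstruct this: once `f n` exceeds the number of
links among the given vertices, the extension property of the template supplies a value of the
branch at `n` compatible with all of them. Every model of `T₀` therefore embeds in one where all
such extensions with no obstruction below `L` are realized. In models with this property a
back-and-forth between tuples with the same equalities, the same edges and the same branches up to
a level yields quantifier elimination, and hence the model completion.

In such a model, a tuple `b` disjoint from `a` can be copied over several tuples `c i` at once, if
these look like `a` up to a high enough level and meet only in constant positions: the vertices of
`b` are added one at a time, and the edges required over different `c i` do not interfere. An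
indiscernible sequence meets only in constant positions, so dividing can come only from equality.
A nonprincipal ultrafilter on `ℕ` extracts a sequence of this kind from an arbitrary one; so along
a branch of a tree property witness, each level forces a new entry into the realization, which has
only finitely many.
-/

namespace ModelNotions

open Filter

universe u v w

/-! ### Sequences of tuples -/

section

variable {α β γ ι I J : Type*}

/-- The tuples `c i` meet only in constant positions: an entry shared by two of them, in whatever
positions, is their common entry in either position. -/
def Coherent (c : I → ι → β) : Prop :=
  ∀ i j l l', c i l = c j l' → c i l = c j l ∧ c i l' = c j l'

theorem Coherent.comp {c : I → ι → β} (hc : Coherent c) (g : J → I) :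
    Coherent fun j => c (g j) :=
  fun i j => hc (g i) (g j)

theorem coherent_of_subsingleton [Subsingleton I] (c : I → ι → β) : Coherent c := by
  intro i j l l' _
  rw [Subsingleton.elim i j]
  exact ⟨rfl, rfl⟩

theorem eventuallyConst_of_finite [Finite γ] (𝓤 : Ultrafilter α) (g : α → γ) :
    EventuallyConst g 𝓤 := by
  obtain ⟨y, hy⟩ := (𝓤.map g).eq_pure_of_finite
  have : Nonempty γ := ⟨y⟩
  refine eventuallyConst_iff_exists_eventuallyEq.2 ⟨y, ?_⟩
  have h : {y} ∈ 𝓤.map g := hy ▸ rfl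
  exact h

theorem eventually_ne_of_not_eventuallyConst {𝓤 : Ultrafilter α} {f : α → β}
    (hf : ¬ EventuallyConst f 𝓤) (x : β) : ∀ᶠ i in 𝓤, f i ≠ x :=
  have : Nonempty β := ⟨x⟩
  Ultrafilter.eventually_not.2 fun hx => hf (eventuallyConst_iff_exists_eventuallyEq.2 ⟨x, hx⟩)

theorem exists_eventually_eq_of_eventuallyConst {F : Filter α} [F.NeBot] {f : α → β}
    (hf : EventuallyConst f F) : ∃ x, ∀ᶠ i in F, f i = x :=
  have : Nonempty β := F.nonempty_of_neBot.map f
  eventuallyConst_iff_exists_eventuallyEq.1 hf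

theorem eventually_eventually_eq_of_eventuallyConst {F : Filter α} [F.NeBot] {f : α → β}
    (hf : EventuallyConst f F) : ∀ᶠ i in F, ∀ᶠ j in F, f i = f j := by
  obtain ⟨x, hx⟩ := exists_eventually_eq_of_eventuallyConst hf
  filter_upwards [hx] with i hi
  filter_upwards [hx] with j hj using hi.trans hj.symm

theorem eventually_eventually_ne_of_not_eventuallyConst {𝓤 : Ultrafilter α} {f g : α → β}
    (h : ¬ (EventuallyConst f 𝓤 ∧ EventuallyConst g 𝓤)) :
    ∀ᶠ i in 𝓤, ∀ᶠ j in 𝓤, f i ≠ g j := by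
  by_cases hg : EventuallyConst g 𝓤
  · obtain ⟨y, hy⟩ := exists_eventually_eq_of_eventuallyConst hg
    filter_upwards [eventually_ne_of_not_eventuallyConst (fun hf => h ⟨hf, hg⟩) y] with i hi
    filter_upwards [hy] with j hj using hj ▸ hi
  · exact Eventually.of_forall fun i =>
      (eventually_ne_of_not_eventuallyConst hg (f i)).mono fun _ => Ne.symm

theorem eventually_eventually_coherent [Finite ι] (𝓤 : Ultrafilter α) (s : α → ι → β) :
    ∀ᶠ i in 𝓤, ∀ᶠ j in 𝓤, ∀ l l', s i l = s j l' → s i l = s j l ∧ s i l' = s j l' := by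
  simp only [eventually_all]
  intro l l'
  by_cases h : EventuallyConst (s · l) 𝓤 ∧ EventuallyConst (s · l') 𝓤
  · filter_upwards [eventually_eventually_eq_of_eventuallyConst h.1,
      eventually_eventually_eq_of_eventuallyConst h.2] with i hi hi'
    filter_upwards [hi, hi'] with j hj hj' _ using ⟨hj, hj'⟩
  · filter_upwards [eventually_eventually_ne_of_not_eventuallyConst h] with i hi
    filter_upwards [hi] with j hj h using absurd h hj

theorem exists_injective_of_eventually {P : ℕ → Prop} {R : ℕ → ℕ → Prop} [Std.Symm R]
    (hP : ∀ᶠ i in hyperfilter ℕ, P i)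
    (hR : ∀ᶠ i in hyperfilter ℕ, ∀ᶠ j in hyperfilter ℕ, R i j) :
    ∃ f : ℕ → ℕ, f.Injective ∧ (∀ i, P (f i)) ∧ Pairwise fun i j => R (f i) (f j) := by
  have : Std.Symm fun i j => i ≠ j ∧ R i j := ⟨fun i j h => ⟨h.1.symm, symm h.2⟩⟩
  obtain ⟨f, hf, hfR⟩ := exists_seq_of_forall_finset_exists'
    (fun i => P i ∧ ∀ᶠ j in hyperfilter ℕ, R i j) (fun i j => i ≠ j ∧ R i j) fun S hS => by
      have hne : ∀ᶠ j in hyperfilter ℕ, j ∉ S :=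
        hyperfilter_le_cofinite S.finite_toSet.compl_mem_cofinite
      have hRS := (eventually_all_finset S).2 fun i hi => (hS i hi).2
      obtain ⟨j, hj, hjS, hjR⟩ := ((hP.and hR).and (hne.and hRS)).exists
      exact ⟨j, hj, fun i hi => ⟨fun h => hjS (h ▸ hi), hjR i hi⟩⟩
  exact ⟨f, fun i j h => by_contra fun hij => (hfR hij).1 h, fun i => (hf i).1,
    fun i j hij => (hfR hij).2⟩

theorem exists_coherent_subsequence [Finite ι] (s : ℕ → ι → β) {P : ℕ → Prop}
    (hP : ∀ᶠ i in hyperfilter ℕ, P i) :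
    ∃ f : ℕ → ℕ, f.Injective ∧ (∀ i, P (f i)) ∧ Coherent (fun i => s (f i)) ∧
      ∀ l, EventuallyConst (s · l) (hyperfilter ℕ) → ∀ i j, s (f i) l = s (f j) l := by
  let R i j := (∀ l l', s i l = s j l' → s i l = s j l ∧ s i l' = s j l') ∧
    ∀ l, EventuallyConst (s · l) (hyperfilter ℕ) → s i l = s j l
  have : Std.Symm R := ⟨fun i j h => ⟨fun l l' hl =>
    (h.1 l' l hl.symm).symm.imp Eq.symm Eq.symm, fun l hl => (h.2 l hl).symm⟩⟩
  have hconst : ∀ᶠ i in hyperfilter ℕ, ∀ᶠ j in hyperfilter ℕ,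
      ∀ l, EventuallyConst (s · l) (hyperfilter ℕ) → s i l = s j l := by
    simp only [eventually_all]
    exact fun l hl => eventually_eventually_eq_of_eventuallyConst hl
  obtain ⟨f, hf, hfP, hfR⟩ := exists_injective_of_eventually (R := R) hP <| by
    filter_upwards [eventually_eventually_coherent _ s, hconst] with i hi hi' using hi.and hi'
  refine ⟨f, hf, hfP, fun i j l l' h => ?_, fun l hl i j => ?_⟩ <;>
  rcases eq_or_ne i j with rfl | hij
  · exact ⟨rfl, rfl⟩
  · exact (hfR hij).1 l l' h
  · rfl
  · exact (hfR hij).2 l hl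

theorem exists_branch_of_forall_exists {P : List α → α → Prop} (h : ∀ η, ∃ i, P η i) :
    ∃ σ : ℕ → α, ∀ j, P (List.ofFn fun i : Fin j => σ i) (σ j) := by
  choose next hnext using h
  let path : ℕ → List α := fun j => Nat.rec [] (fun _ η => η ++ [next η]) j
  have hpath : ∀ j, (List.ofFn fun i : Fin j => next (path i)) = path j := by
    intro j
    induction j with
    | zero => rfl
    | succ j ih =>
      simp only [List.ofFn_succ_last, Fin.val_castSucc, Fin.val_last, ih]
      rfl
  refine ⟨fun j => next (path j), fun j => ?_⟩
  rw [hpath]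
  exact hnext _

theorem exists_branch_forall_ne [Finite ι] (a : List ℕ → ι → β) {P : List ℕ → ℕ → Prop}
    (hP : ∀ η, ∀ᶠ i in hyperfilter ℕ, P η i) :
    ∃ σ : ℕ → ℕ, ∀ j, P (List.ofFn fun i : Fin j => σ i) (σ j) ∧ ∀ j' ≤ j, ∀ l l',
      ¬ EventuallyConst (fun i => a ((List.ofFn fun i : Fin j => σ i) ++ [i]) l)
        (hyperfilter ℕ) →
      a (List.ofFn fun i : Fin (j + 1) => σ i) l ≠ a (List.ofFn fun i : Fin j' => σ i) l' := by
  have hne : ∀ η, ∀ᶠ i in hyperfilter ℕ, ∀ q ∈ Set.Iic η.length, ∀ l l',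
      ¬ EventuallyConst (fun i => a (η ++ [i]) l) (hyperfilter ℕ) →
      a (η ++ [i]) l ≠ a (η.take q) l' := by
    intro η
    simp only [eventually_all_finite (Set.finite_Iic _), eventually_all]
    exact fun q _ l l' hl => eventually_ne_of_not_eventuallyConst hl _
  obtain ⟨σ, hσ⟩ := exists_branch_of_forall_exists fun η => ((hP η).and (hne η)).exists
  refine ⟨σ, fun j => ⟨(hσ j).1, fun j' hj' l l' hl => ?_⟩⟩
  have h := (hσ j).2 j' (by simpa using hj') l l' hl
  rw [← Fin.ofFn_take_eq_take_ofFn hj'] at h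
  rwa [List.ofFn_succ_last]

end

/-! ### First-order preliminaries -/

section

variable {L : FirstOrder.Language.{u, v}}

theorem isQF_iInf {α β : Type*} [Finite β] {n : ℕ} {f : β → L.BoundedFormula α n}
    (hf : ∀ b, (f b).IsQF) : (BoundedFormula.iInf f).IsQF := by
  dsimp only [BoundedFormula.iInf]
  generalize Finset.toList _ = l
  induction l with
  | nil => exact BoundedFormula.IsQF.top
  | cons b l ih => exact (hf b).inf ih

theorem IsModelCompletion.model_base {T T' : L.Theory} (hT : IsModelCompletion T T')
    (M : Theory.ModelType.{u, v, max u v} T') : M ⊨ T :=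
  (Theory.model_iff _).2 fun φ hφ => (hT.extends_base φ hφ).realize_sentence M

theorem IsModelCompletion.realize_of_isExistential {T T' : L.Theory}
    (hT : IsModelCompletion T T') (M : Theory.ModelType.{u, v, max u v} T')
    {P : Type max u v} [L.Structure P] (hP : P ⊨ T) (f : M ↪[L] P) {α : Type*} {n : ℕ}
    {φ : L.BoundedFormula α n} (hφ : φ.IsExistential) {x : α → M} {y : Fin n → M}
    (h : φ.Realize (f ∘ x) (f ∘ y)) : φ.Realize x y := by
  have : Nonempty P := M.nonempty'.map f
  have : M ⊨ T := hT.model_base M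
  obtain ⟨N, ⟨g⟩⟩ := hT.embeds ⟨P⟩
  let g' : P ↪[L] N := g
  have h_diagram := hT.diagram_complete ⟨M⟩ N M (g'.comp f) (Embedding.refl _ _)
    (φ.toFormula.relabel (Sum.elim x y))
  simp only [Formula.realize_relabel, BoundedFormula.realize_toFormula] at h_diagram
  exact h_diagram.1 (hφ.realize_embedding g' h)

theorem SameTypeOver.realize_iff {M : Type w} [L.Structure M] {n : ℕ} {A : Set M}
    {s t : Fin n → M} (h : SameTypeOver (L := L) A s t) (φ : L.Formula (Fin n)) :
    φ.Realize s ↔ φ.Realize t := by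
  have := h (φ.relabel Sum.inr)
  rwa [Formula.realize_relabel, Formula.realize_relabel, Sum.elim_comp_inr,
    Sum.elim_comp_inr] at this

theorem sameTypeOver_empty {M : Type w} [L.Structure M] {n : ℕ} {s t : Fin n → M}
    (h : ∀ φ : L.Formula (Fin n), φ.Realize s ↔ φ.Realize t) :
    SameTypeOver (L := L) ∅ s t := by
  intro φ
  have := h (φ.relabel (Equiv.emptySum _ _))
  simp only [Formula.realize_relabel] at this
  convert this using 2 <;>
  · funext z
    rcases z with z | z
    · exact isEmptyElim z
    · rfl

/-! ### Indiscernible sequences -/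

section

variable {M : Type w} [L.Structure M] {I : Type*} [LinearOrder I] {n : ℕ} {a : I → Fin n → M}

theorem IsIndiscernible.realize_iff (ha : IsIndiscernible L a) (φ : L.Formula (Fin n))
    (i j : I) : φ.Realize (a i) ↔ φ.Realize (a j) := by
  have := ha 1 (φ.relabel fun x => (0, x)) (fun _ => i) (fun _ => j)
    (Subsingleton.strictMono _) (Subsingleton.strictMono _)
  rwa [Formula.realize_relabel, Formula.realize_relabel] at this

theorem IsIndiscernible.eq_of_lt (ha : IsIndiscernible L a) {i j i' j' : I} (hij : i < j)
    (hij' : i' < j') {l l' : Fin n} (h : a i l = a j l') : a i' l = a j' l' := by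
  have := ha 2 (Term.equal (Term.var (0, l)) (Term.var (1, l'))) ![i, j] ![i', j']
    (by simpa [Fin.strictMono_iff_lt_succ] using hij)
    (by simpa [Fin.strictMono_iff_lt_succ] using hij')
  rw [Formula.realize_equal, Formula.realize_equal] at this
  exact this.1 h

theorem exists_lt_lt (I : Type*) [LinearOrder I] [Infinite I] : ∃ p q s : I, p < q ∧ q < s := by
  obtain ⟨t, ht⟩ := Infinite.exists_subset_card_eq I 3
  let e := t.orderEmbOfFin ht
  exact ⟨e 0, e 1, e 2, e.strictMono (by decide), e.strictMono (by decide)⟩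

theorem IsIndiscernible.coherent [Infinite I] (ha : IsIndiscernible L a) : Coherent a := by
  obtain ⟨p, q, s, hpq, hqs⟩ := exists_lt_lt I
  have of_lt : ∀ {i j l l'}, i < j → a i l = a j l' → a i l = a j l ∧ a i l' = a j l' := by
    intro i j l l' hij h
    have hps : a p l = a s l' := ha.eq_of_lt hij (hpq.trans hqs) h
    have hpq' : a p l = a q l' := ha.eq_of_lt hij hpq h
    have hqs' : a q l = a s l' := ha.eq_of_lt hij hqs h
    exact ⟨ha.eq_of_lt hpq hij (hps.trans hqs'.symm),
      ha.eq_of_lt hqs hij (hpq'.symm.trans hps)⟩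
  intro i j l l' h
  rcases lt_trichotomy i j with hij | rfl | hij
  · exact of_lt hij h
  · exact ⟨rfl, rfl⟩
  · exact (of_lt hij h.symm).symm.imp Eq.symm Eq.symm

end

/-! ### Dividing and forking -/

section

variable {M : Type w} [L.Structure M] {m n : ℕ} {A B : Set M} {φ : L.Formula (Fin m ⊕ Fin n)}
  {a : Fin n → M} {b : Fin m → M}

theorem image_refl (A : Set M) : ElementaryEmbedding.refl L M '' A = A :=
  Set.image_id A

theorem Divides.forks (h : Divides A φ a) : Forks A φ a :=
  ⟨M, inferInstance, ElementaryEmbedding.refl _ _, 1, fun _ => n, fun _ => φ, fun _ => a,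
    fun _ => (image_refl (L := L) A).symm ▸ h, fun _ hb => ⟨0, hb⟩⟩

theorem suRankGE_one_of_divides (h : Divides A φ a) (hφ : φ.Realize (Sum.elim b a)) :
    SURankGE L 1 M A b := by
  refine ⟨M, inferInstance, ElementaryEmbedding.refl _ _, A ∪ Set.range a, ?_⟩
  rw [image_refl (L := L)]
  exact ⟨Set.subset_union_left, ⟨n, φ, a, fun i => Or.inr ⟨i, rfl⟩, hφ, h.forks⟩, trivial⟩

theorem not_divides_of_mem (hb : ∀ j, b j ∈ A) (hφ : φ.Realize (Sum.elim b a)) :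
    ¬ Divides A φ a := by
  rintro ⟨N, _, f, r, s, hs, hincon⟩
  refine hincon (Finset.range r) (Finset.card_range r) ⟨f ∘ b, fun i _ => ?_⟩
  have := hs i (φ.relabel (Sum.map (fun j => ⟨f (b j), Set.mem_image_of_mem f (hb j)⟩) id))
  simp only [Formula.realize_relabel, Sum.elim_comp_map, Function.comp_id] at this
  have hφf := (f.map_formula φ (Sum.elim b a)).2 hφ
  rw [Sum.comp_elim] at hφf
  exact this.2 hφf

theorem not_typeForks_of_mem (hb : ∀ j, b j ∈ A) : ¬ TypeForks L A B b := by
  rintro ⟨n, φ, a, -, hφ, N, _, f, l, p, ψ, c, hdiv, himp⟩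
  obtain ⟨i, hi⟩ := himp (f ∘ b) (by
    rw [← Sum.comp_elim]
    exact (f.map_formula φ _).2 hφ)
  exact not_divides_of_mem (fun j => Set.mem_image_of_mem f (hb j)) hi (hdiv i)

theorem divides_equal {N : Type w} [L.Structure N] (f : M ↪ₑ[L] N) {a : Fin 1 → M}
    {s : ℕ → Fin 1 → N} (hs : ∀ i, SameTypeOver (L := L) (f '' A) (s i) (f ∘ a))
    (hinj : Function.Injective s) :
    Divides A (Term.equal (Term.var (Sum.inl 0)) (Term.var (Sum.inr 0)) :
      L.Formula (Fin 1 ⊕ Fin 1)) a := by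
  refine ⟨N, inferInstance, f, 2, s, hs, ?_⟩
  rintro S hS ⟨x, hx⟩
  obtain ⟨i, j, hij, rfl⟩ := Finset.card_eq_two.1 hS
  have hi := hx i (by simp)
  have hj := hx j (by simp)
  rw [Formula.realize_equal] at hi hj
  refine hij (hinj (funext fun z => ?_))
  rw [Subsingleton.elim z 0]
  exact hi.symm.trans hj

end

end

end ModelNotions

namespace HypergraphTemplate

open ModelNotions

universe w

variable {k : ℕ} {𝓗 : Template k}

/-! ### Tuples with a distinguished entry -/

/-- Positions of the entries of a `k`-tuple other than the initial one. -/
abbrev Link (k : ℕ) := {j : Fin k // (j : ℕ) ≠ 0}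

/-- The `k`-tuple with initial entry `d` and remaining entries `w`, in the shape in which it occurs
in `Template.extension`. -/
def cons {V : Type*} (d : V) (w : Link k → V) : Fin k → V :=
  fun j => if h : (j : ℕ) ≠ 0 then w ⟨j, h⟩ else d

section

variable {V V' ι : Type*} {d : V} {w : Link k → V}

theorem cons_of_eq_zero (d : V) (w : Link k → V) {j : Fin k} (hj : (j : ℕ) = 0) :
    cons d w j = d :=
  dif_neg (not_not.2 hj)

theorem cons_link (d : V) (w : Link k → V) (j : Link k) : cons d w j = w j :=
  dif_pos j.2

theorem comp_cons (g : V → V') (d : V) (w : Link k → V) :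
    g ∘ cons d w = cons (g d) (g ∘ w) := by
  funext j
  simp only [Function.comp, cons]
  split_ifs <;> rfl

theorem cons_comp_perm (d : V) (w : Link k → V) (τ : Equiv.Perm (Link k)) :
    cons d (w ∘ τ) = cons d w ∘ Equiv.Perm.ofSubtype τ := by
  funext j
  by_cases hj : (j : ℕ) = 0
  · rw [Function.comp_apply, Equiv.Perm.ofSubtype_apply_of_not_mem τ (not_not.2 hj),
      cons_of_eq_zero _ _ hj, cons_of_eq_zero _ _ hj]
  · rw [Function.comp_apply, Equiv.Perm.ofSubtype_apply_of_mem τ hj, cons_link,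
      cons_link d (w ∘ τ) ⟨j, hj⟩, Function.comp_apply]

theorem image_cons_ne (d : V) (w : Link k → V) {j : Fin k} (hj : (j : ℕ) = 0) :
    cons d w '' {i | i ≠ j} = Set.range w := by
  have hne : {i | i ≠ j} = {i : Fin k | (i : ℕ) ≠ 0} := by
    ext i
    rw [Set.mem_ofPred_eq, Set.mem_ofPred_eq, ne_eq, Fin.ext_iff, hj]
  rw [hne, Set.image_eq_range]
  exact congrArg Set.range (funext (cons_link d w))

theorem injective_cons (hw : Function.Injective w) (hd : ∀ j, w j ≠ d) :
    Function.Injective (cons d w) := by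
  intro i j hij
  by_cases hi : (i : ℕ) = 0 <;> by_cases hj : (j : ℕ) = 0
  · exact Fin.ext (hi.trans hj.symm)
  · rw [cons_of_eq_zero _ _ hi, cons_link d w ⟨j, hj⟩] at hij
    exact absurd hij.symm (hd _)
  · rw [cons_of_eq_zero _ _ hj, cons_link d w ⟨i, hi⟩] at hij
    exact absurd hij (hd _)
  · rw [cons_link d w ⟨i, hi⟩, cons_link d w ⟨j, hj⟩] at hij
    exact congrArg Subtype.val (hw hij)

theorem injective_of_injective_cons (h : Function.Injective (cons d w)) :
    Function.Injective w := by
  intro i j hij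
  rw [← cons_link d w, ← cons_link d w] at hij
  exact Subtype.ext (h hij)

theorem exists_perm_of_range_eq {w w' : ι → V} (hw : Function.Injective w)
    (hw' : Function.Injective w') (h : Set.range w = Set.range w') :
    ∃ τ : Equiv.Perm ι, w = w' ∘ τ := by
  refine ⟨(Equiv.ofInjective w hw).trans ((Equiv.setCongr h).trans
    (Equiv.ofInjective w' hw').symm), ?_⟩
  funext j
  simp [Equiv.apply_ofInjective_symm hw']

theorem exists_perm_eq_cons_none {v : Fin k → Option ι} (hv : Function.Injective v) {j : Fin k}
    (hj : v j = none) :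
    ∃ (σ : Equiv.Perm (Fin k)) (u : Link k → ι), v ∘ σ = cons none (some ∘ u) := by
  let i₀ : Fin k := ⟨0, j.pos⟩
  let σ := Equiv.swap i₀ j
  have hσ : v (σ i₀) = none := by rw [Equiv.swap_apply_left, hj]
  have hlink : ∀ l : Link k, ∃ i, v (σ l) = some i := fun l =>
    Option.ne_none_iff_exists'.1 fun hl =>
      l.2 (congrArg Fin.val (σ.injective (hv (hl.trans hσ.symm))))
  choose u hu using hlink
  refine ⟨σ, u, funext fun l => ?_⟩
  by_cases hl : (l : ℕ) = 0
  · obtain rfl : l = i₀ := Fin.ext hl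
    rw [cons_of_eq_zero _ _ hl, Function.comp_apply, hσ]
  · rw [cons_link none (some ∘ u) ⟨l, hl⟩]
    exact hu ⟨l, hl⟩

end

/-! ### Branches of the tree -/

/-- The infinite branches of the tree `X`. -/
abbrev Branch (𝓗 : Template k) := ∀ n, Fin (𝓗.H n)

theorem Template.k_pos (𝓗 : Template k) : 0 < k := two_pos.trans_le 𝓗.two_le

theorem Template.E_comp_perm (𝓗 : Template k) {n : ℕ} {v : Fin k → Fin (𝓗.H n)} (h : 𝓗.E n v)
    (σ : Equiv.Perm (Fin k)) : 𝓗.E n (v ∘ σ) := by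
  by_cases hv : Function.Injective v
  · exact (𝓗.full n).symm v hv h σ
  · exact (𝓗.full n).of_not_injective _ fun hi => hv ((σ.injective_comp v).1 hi)

instance (𝓗 : Template k) (n : ℕ) : Nonempty (Fin (𝓗.H n)) :=
  ⟨⟨0, (𝓗.f_pos n).trans_le (𝓗.f_le n)⟩⟩

/-- The branch `s` passes through the node `η`. -/
def Through (s : Branch 𝓗) (η : Node 𝓗) : Prop := ∀ i : Fin η.lgn, s i = η.val i

/-- The initial segment of length `L` of the branch `s`. -/
def initial (s : Branch 𝓗) (L : ℕ) : Node 𝓗 := ⟨L, fun i => s i⟩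

section

variable {s t : Branch 𝓗} {η ν : Node 𝓗} {L L' : ℕ}

theorem through_initial_iff : Through s (initial t L) ↔ ∀ n < L, s n = t n :=
  ⟨fun h n hn => h ⟨n, hn⟩, fun h i => h i i.2⟩

theorem through_initial_self (s : Branch 𝓗) (L : ℕ) : Through s (initial s L) := fun _ => rfl

theorem initial_eq_of_through (h : Through s η) : initial s η.lgn = η := by
  obtain ⟨L, v⟩ := η
  exact congrArg (Node.mk L) (funext h)

theorem initial_congr (h : ∀ n < L, s n = t n) : initial s L = initial t L :=
  initial_eq_of_through (through_initial_iff.2 h)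

theorem through_root (s : Branch 𝓗) : Through s (Node.root 𝓗) := fun i => i.elim0

theorem Through.of_isInitial (hs : Through s ν) (h : η.IsInitial ν) : Through s η := by
  obtain ⟨hle, hv⟩ := h
  exact fun i => (hs (Fin.castLE hle i)).trans (hv i)

theorem through_append_iff {i : Fin (𝓗.H η.lgn)} :
    Through s (η.append i) ↔ Through s η ∧ s η.lgn = i := by
  refine (Fin.forall_fin_succ' (n := η.lgn)).trans (and_congr ?_ ?_)
  · simp [Node.append, Through]
  · simp [Node.append]

theorem initial_isInitial (s : Branch 𝓗) (h : L ≤ L') : (initial s L).IsInitial (initial s L') :=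
  ⟨h, fun _ => rfl⟩

theorem append_initial (h : ∀ n < L, s n = t n) :
    (initial s L).append (t L) = initial t (L + 1) :=
  (initial_eq_of_through (through_append_iff.2
    ⟨through_initial_iff.2 fun n hn => (h n hn).symm, rfl⟩)).symm

theorem exists_through (η : Node 𝓗) : ∃ s : Branch 𝓗, Through s η := by
  classical
  exact ⟨fun n => if h : n < η.lgn then η.val ⟨n, h⟩ else Classical.arbitrary _, fun i => by simp⟩

end

/-! ### Models of the universal theory -/

section

variable {M : Type w} [(lang 𝓗).Structure M]

variable (𝓗) in
/-- The relation `R` of a structure. -/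
def Edge (v : Fin k → M) : Prop := Structure.RelMap (symR 𝓗) v

/-- The predicate `Q_η` of a structure. -/
def Pred (η : Node 𝓗) (x : M) : Prop := Structure.RelMap (symQ η) ![x]

variable (𝓗) in
/-- The branch of the nodes `η` for which `Q_η` holds of `x`; an arbitrary branch if these nodes do
not form a branch, which does not happen in a model of `T₀`. -/
noncomputable def branchOf (x : M) : Branch 𝓗 :=
  Classical.epsilon fun s => ∀ η, Pred η x ↔ Through s η

theorem branchOf_eq {x : M} {s : Branch 𝓗} (hs : ∀ η, Pred η x ↔ Through s η) :
    branchOf 𝓗 x = s := by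
  have h : ∀ η, Pred η x ↔ Through (branchOf 𝓗 x) η :=
    Classical.epsilon_spec (p := fun s => ∀ η, Pred η x ↔ Through s η) ⟨s, hs⟩
  funext n
  exact through_initial_iff.1 ((h _).1 ((hs _).2 (through_initial_self s (n + 1)))) n n.lt_succ_self

variable (𝓗 M) in
/-- The axioms of `T₀`, read in a structure. -/
structure BaseLaws : Prop where
  injective : ∀ {v : Fin k → M}, Edge 𝓗 v → Function.Injective v
  comp_perm : ∀ {v : Fin k → M}, Edge 𝓗 v → ∀ σ : Equiv.Perm (Fin k), Edge 𝓗 (v ∘ σ)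
  root : ∀ x : M, Pred (Node.root 𝓗) x
  mono : ∀ {η ν : Node 𝓗} {x : M}, η.IsInitial ν → Pred ν x → Pred η x
  disjoint : ∀ {η : Node 𝓗} {i j} {x : M}, Pred (η.append i) x → Pred (η.append j) x → i = j
  exists_append : ∀ {η : Node 𝓗} {x : M}, Pred η x → ∃ i, Pred (η.append i) x
  template_edge : ∀ {v : Fin k → M} {η : Fin k → Node 𝓗} {n} (hn : ∀ j, n < (η j).lgn),
    (∀ j, Pred (η j) (v j)) → Edge 𝓗 v → 𝓗.E n fun j => (η j).val ⟨n, hn j⟩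

variable (𝓗 M) in
/-- A semantic form of `T₀`: every element lies on a branch of the tree, and `R` is a symmetric
irreflexive hypergraph whose edges are mapped to edges of the template at every level. -/
structure IsBaseModel : Prop where
  injective : ∀ {v : Fin k → M}, Edge 𝓗 v → Function.Injective v
  comp_perm : ∀ {v : Fin k → M}, Edge 𝓗 v → ∀ σ : Equiv.Perm (Fin k), Edge 𝓗 (v ∘ σ)
  template_edge : ∀ {v : Fin k → M}, Edge 𝓗 v → ∀ n, 𝓗.E n fun j => branchOf 𝓗 (v j) n
  pred_iff : ∀ {η : Node 𝓗} {x : M}, Pred η x ↔ Through (branchOf 𝓗 x) η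

section

variable {n : ℕ} {v : Empty → M} {xs : Fin n → M}

theorem realize_atomR {t : Fin k → Fin n} : (atomR 𝓗 t).Realize v xs ↔ Edge 𝓗 (xs ∘ t) := by
  simp only [atomR, BoundedFormula.realize_rel]
  rfl

theorem realize_atomQ {η : Node 𝓗} {j : Fin n} : (atomQ η j).Realize v xs ↔ Pred η (xs j) := by
  simp only [atomQ, BoundedFormula.realize_rel₁]
  rfl

theorem realize_sentence_alls {φ : (lang 𝓗).BoundedFormula Empty n} :
    Sentence.Realize M φ.alls ↔ ∀ xs : Fin n → M, φ.Realize default xs := by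
  rw [Sentence.Realize, BoundedFormula.realize_alls]

end

theorem BaseLaws.model (h : BaseLaws 𝓗 M) : M ⊨ baseTheory 𝓗 := by
  refine (Theory.model_iff _).2 fun φ (hφ : BaseAxiom 𝓗 φ) => ?_
  cases hφ <;>
    simp only [realize_sentence_alls, BoundedFormula.realize_imp, BoundedFormula.realize_not,
      BoundedFormula.realize_inf, BoundedFormula.realize_iSup, BoundedFormula.realize_iInf,
      BoundedFormula.realize_bdEqual, realize_atomR, realize_atomQ]
  case irrefl i j hij => exact fun _ he hx => hij (h.injective he hx)
  case symm σ => exact fun _ he => h.comp_perm he σ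
  case root => exact fun _ => h.root _
  case refine η ν hην => exact fun _ => h.mono hην
  case disjoint η i j hij => exact fun _ hx => hij (h.disjoint hx.1 hx.2)
  case cover η => exact fun _ => h.exists_append
  case edge η n hn hE => exact fun _ hη he => hE (h.template_edge hn hη he)

theorem baseLaws_of_model (hM : M ⊨ baseTheory 𝓗) : BaseLaws 𝓗 M := by
  have holds {n : ℕ} {φ : (lang 𝓗).BoundedFormula Empty n} (h : BaseAxiom 𝓗 φ.alls) :
      ∀ xs : Fin n → M, φ.Realize default xs :=
    realize_sentence_alls.1 ((Theory.model_iff _).1 hM _ h)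
  constructor
  case injective =>
    refine fun {v} he i j hij => by_contra fun hne => ?_
    have := holds (.irrefl i j hne) v
    rw [BoundedFormula.realize_imp, realize_atomR] at this
    exact this he hij
  case comp_perm =>
    refine fun {v} he σ => ?_
    have := holds (.symm σ) v
    rw [BoundedFormula.realize_imp, realize_atomR, realize_atomR] at this
    exact this he
  case root => exact fun x => realize_atomQ.1 (holds .root fun _ => x)
  case mono =>
    refine fun {η ν x} hην hx => ?_
    have := holds (.refine η ν hην) fun _ => x
    rw [BoundedFormula.realize_imp, realize_atomQ, realize_atomQ] at this
    exact this hx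
  case disjoint =>
    refine fun {η i j x} hi hj => by_contra fun hne => ?_
    have := holds (.disjoint η i j hne) fun _ => x
    rw [BoundedFormula.realize_not, BoundedFormula.realize_inf, realize_atomQ,
      realize_atomQ] at this
    exact this ⟨hi, hj⟩
  case exists_append =>
    refine fun {η x} hx => ?_
    have := holds (.cover η) fun _ => x
    simp only [BoundedFormula.realize_imp, BoundedFormula.realize_iSup, realize_atomQ] at this
    exact this hx
  case template_edge =>
    refine fun {v η n} hn hη he => by_contra fun hE => ?_
    have := holds (.edge η n hn hE) v
    simp only [BoundedFormula.realize_imp, BoundedFormula.realize_iInf, BoundedFormula.realize_not,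
      realize_atomQ, realize_atomR] at this
    exact this hη he

namespace BaseLaws

theorem exists_pred_initial (h : BaseLaws 𝓗 M) (x : M) (L : ℕ) :
    ∃ s : Branch 𝓗, Pred (initial s L) x := by
  induction L with
  | zero =>
    obtain ⟨s, hs⟩ := exists_through (Node.root 𝓗)
    exact ⟨s, (initial_eq_of_through hs).symm ▸ h.root x⟩
  | succ L ih =>
    obtain ⟨s, hs⟩ := ih
    obtain ⟨i, hi⟩ := h.exists_append hs
    obtain ⟨t, ht⟩ := exists_through ((initial s L).append i)
    exact ⟨t, (initial_eq_of_through ht).symm ▸ hi⟩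

theorem eq_of_pred_initial (h : BaseLaws 𝓗 M) {x : M} {s t : Branch 𝓗} {L : ℕ}
    (hs : Pred (initial s L) x) (ht : Pred (initial t L) x) : ∀ n < L, s n = t n := by
  induction L with
  | zero => exact fun n hn => absurd hn n.not_lt_zero
  | succ L ih =>
    have hlt : ∀ n < L, s n = t n :=
      ih (h.mono (initial_isInitial s L.le_succ) hs) (h.mono (initial_isInitial t L.le_succ) ht)
    have hL : s L = t L := by
      rw [← append_initial fun _ _ => rfl] at hs
      rw [← append_initial hlt] at ht
      exact h.disjoint hs ht
    exact fun n hn => (Nat.lt_succ_iff_lt_or_eq.1 hn).elim (hlt n) fun h => h ▸ hL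

theorem exists_branch (h : BaseLaws 𝓗 M) (x : M) :
    ∃ s : Branch 𝓗, ∀ η, Pred η x ↔ Through s η := by
  choose S hS using h.exists_pred_initial x
  let s : Branch 𝓗 := fun n => S (n + 1) n
  have agree (L : ℕ) : ∀ n < L, s n = S L n := fun n hn =>
    h.eq_of_pred_initial (hS (n + 1)) (h.mono (initial_isInitial _ hn) (hS L)) n n.lt_succ_self
  have hs (L : ℕ) : Pred (initial s L) x := initial_congr (agree L) ▸ hS L
  refine ⟨s, fun η => ⟨fun hη => ?_, fun hη => initial_eq_of_through hη ▸ hs _⟩⟩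
  obtain ⟨t, ht⟩ := exists_through η
  rw [← initial_eq_of_through ht] at hη ⊢
  exact through_initial_iff.2 (h.eq_of_pred_initial (hs _) hη)

theorem isBaseModel (h : BaseLaws 𝓗 M) : IsBaseModel 𝓗 M where
  injective := h.injective
  comp_perm := h.comp_perm
  pred_iff {η x} := by
    obtain ⟨s, hs⟩ := h.exists_branch x
    rw [branchOf_eq hs]
    exact hs η
  template_edge {v} he n := by
    choose s hs using h.exists_branch
    simp only [branchOf_eq (hs _)]
    exact h.template_edge (η := fun j => initial (s (v j)) (n + 1)) (fun _ => n.lt_succ_self)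
      (fun j => (hs _ _).2 (through_initial_self _ _)) he

end BaseLaws

theorem isBaseModel_of_model (hM : M ⊨ baseTheory 𝓗) : IsBaseModel 𝓗 M :=
  (baseLaws_of_model hM).isBaseModel

namespace IsBaseModel

theorem of_branches (s : M → Branch 𝓗)
    (pred_iff : ∀ (η : Node 𝓗) (x : M), Pred η x ↔ Through (s x) η)
    (injective : ∀ {v : Fin k → M}, Edge 𝓗 v → Function.Injective v)
    (comp_perm : ∀ {v : Fin k → M}, Edge 𝓗 v → ∀ σ : Equiv.Perm (Fin k), Edge 𝓗 (v ∘ σ))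
    (template_edge : ∀ {v : Fin k → M}, Edge 𝓗 v → ∀ n, 𝓗.E n fun j => s (v j) n) :
    IsBaseModel 𝓗 M := by
  obtain rfl : branchOf 𝓗 = s := funext fun x => branchOf_eq fun η => pred_iff η x
  exact ⟨injective, comp_perm, template_edge, fun {η x} => pred_iff η x⟩

theorem baseLaws (h : IsBaseModel 𝓗 M) : BaseLaws 𝓗 M where
  injective := h.injective
  comp_perm := h.comp_perm
  root _ := h.pred_iff.2 (through_root _)
  mono hην hx := h.pred_iff.2 ((h.pred_iff.1 hx).of_isInitial hην)
  disjoint hi hj := by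
    rw [h.pred_iff, through_append_iff] at hi hj
    exact hi.2.symm.trans hj.2
  exists_append hx := ⟨_, h.pred_iff.2 (through_append_iff.2 ⟨h.pred_iff.1 hx, rfl⟩)⟩
  template_edge {v η n} hn hη he := by
    have := h.template_edge he n
    rwa [show (fun j => branchOf 𝓗 (v j) n) = fun j => (η j).val ⟨n, hn j⟩ from
      funext fun j => h.pred_iff.1 (hη j) ⟨n, hn j⟩] at this

theorem model (h : IsBaseModel 𝓗 M) : M ⊨ baseTheory 𝓗 := h.baseLaws.model

theorem pred_initial_iff (h : IsBaseModel 𝓗 M) {s : Branch 𝓗} {L : ℕ} {x : M} :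
    Pred (initial s L) x ↔ ∀ n < L, branchOf 𝓗 x n = s n :=
  h.pred_iff.trans through_initial_iff

theorem edge_comp_perm_iff (h : IsBaseModel 𝓗 M) {v : Fin k → M} (σ : Equiv.Perm (Fin k)) :
    Edge 𝓗 (v ∘ σ) ↔ Edge 𝓗 v := by
  refine ⟨fun he => ?_, fun he => h.comp_perm he σ⟩
  have := h.comp_perm he σ⁻¹
  rwa [Function.comp_assoc, ← Equiv.Perm.coe_mul, mul_inv_cancel, Equiv.Perm.coe_one,
    Function.comp_id] at this

theorem edge_cons_comp_perm (h : IsBaseModel 𝓗 M) {d : M} {w : Link k → M}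
    (τ : Equiv.Perm (Link k)) : Edge 𝓗 (cons d (w ∘ τ)) ↔ Edge 𝓗 (cons d w) := by
  rw [cons_comp_perm, h.edge_comp_perm_iff]

end IsBaseModel

end

/-! ### Embeddings -/

section

variable {M N : Type*} [(lang 𝓗).Structure M] [(lang 𝓗).Structure N]

theorem map_edge (g : M ↪[lang 𝓗] N) {v : Fin k → M} : Edge 𝓗 (g ∘ v) ↔ Edge 𝓗 v :=
  g.map_rel _ _

theorem relMap_symQ {η : Node 𝓗} (y : Fin 1 → M) :
    Structure.RelMap (symQ η) y ↔ Pred η (y 0) := by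
  rw [Pred, show y = ![y 0] from funext fun i => by rw [Subsingleton.elim i 0]; rfl]
  rfl

theorem map_pred (g : M ↪[lang 𝓗] N) {η : Node 𝓗} {x : M} : Pred η (g x) ↔ Pred η x :=
  (relMap_symQ (g ∘ ![x])).symm.trans (g.map_rel _ _)

theorem branchOf_map (hM : IsBaseModel 𝓗 M) (g : M ↪[lang 𝓗] N) (x : M) :
    branchOf 𝓗 (g x) = branchOf 𝓗 x :=
  branchOf_eq fun _ => (map_pred g).trans hM.pred_iff

/-- The embedding given by an injection which preserves branches and edges. -/
def mkEmbedding (hM : IsBaseModel 𝓗 M) (hN : IsBaseModel 𝓗 N) (g : M ↪ N)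
    (branchOf_map : ∀ x, branchOf 𝓗 (g x) = branchOf 𝓗 x)
    (map_edge : ∀ v : Fin k → M, Edge 𝓗 (g ∘ v) ↔ Edge 𝓗 v) : M ↪[lang 𝓗] N where
  toEmbedding := g
  map_fun' f := nomatch f
  map_rel' r x := by
    cases r with
    | R => exact map_edge x
    | Q η =>
      refine (relMap_symQ _).trans (Iff.trans ?_ (relMap_symQ _).symm)
      rw [hN.pred_iff, hM.pred_iff]
      exact iff_of_eq (congrArg (Through · η) (branchOf_map _))

end

/-! ### Extension axioms -/

/-- From level `L` on, the links with entries among any `m` vertices have a common extension to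
edges of the template. -/
def Template.Large (𝓗 : Template k) (L m : ℕ) : Prop :=
  ∀ n, L ≤ n → m ^ Nat.card (Link k) ≤ 𝓗.f n

theorem Template.Large.mono {L L' m m' : ℕ} (h : 𝓗.Large L m) (hL : L ≤ L') (hm : m' ≤ m) :
    𝓗.Large L' m' :=
  fun n hn => (Nat.pow_le_pow_left hm _).trans (h n (hL.trans hn))

theorem Template.exists_large (𝓗 : Template k) (m : ℕ) : ∃ L, 𝓗.Large L m :=
  Filter.eventually_atTop.1 (𝓗.f_tendsto.eventually_ge_atTop (m ^ Nat.card (Link k)))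

theorem Template.exists_common_vertex (𝓗 : Template k) {n : ℕ} {ι : Type*} [Finite ι]
    (hι : Nat.card ι ^ Nat.card (Link k) ≤ 𝓗.f n) (c : ι → Fin (𝓗.H n)) :
    ∃ s : Fin (𝓗.H n), ∀ t : Link k → ι, 𝓗.E n (cons s (c ∘ t)) := by
  have := Fintype.ofFinite (Link k → ι)
  obtain ⟨e⟩ : Nonempty ((Link k → ι) ↪ Fin (𝓗.f n)) :=
    Function.Embedding.nonempty_of_card_le <| by
      rwa [Fintype.card_fin, ← Nat.card_eq_fintype_card, Nat.card_fun]
  obtain ⟨s, hs⟩ := 𝓗.extension n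
    (Function.extend e (fun t => c ∘ t) fun _ _ => Classical.arbitrary _)
  refine ⟨s, fun t => ?_⟩
  have := hs (e t)
  rwa [e.injective.extend_apply] at this

theorem Template.Large.exists_branch {ι : Type*} [Finite ι] {L : ℕ} (h : 𝓗.Large L (Nat.card ι))
    (s : Branch 𝓗) (c : ι → Branch 𝓗) : ∃ s' : Branch 𝓗, (∀ n < L, s' n = s n) ∧
      ∀ n, L ≤ n → ∀ t : Link k → ι, 𝓗.E n (cons (s' n) fun j => c (t j) n) := by
  have hs (n : ℕ) : ∃ y : Fin (𝓗.H n), (n < L → y = s n) ∧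
      (L ≤ n → ∀ t : Link k → ι, 𝓗.E n (cons y fun j => c (t j) n)) := by
    rcases lt_or_ge n L with hn | hn
    · exact ⟨s n, fun _ => rfl, fun h => absurd hn h.not_gt⟩
    · obtain ⟨y, hy⟩ := 𝓗.exists_common_vertex (h n hn) fun i => c i n
      exact ⟨y, fun h => absurd hn h.not_ge, fun _ => hy⟩
  choose s' hlt hge using hs
  exact ⟨s', hlt, hge⟩

section

variable {M : Type w} [(lang 𝓗).Structure M] {m L : ℕ} {s : Branch 𝓗} {ν : Fin m → Branch 𝓗}
  {W : Set (Set (Fin m))} {v : Empty → M} {a : Fin m → M}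

open Classical in
/-- The formula in `x_0, …, x_{m-1}` saying that there is a vertex other than these on the initial
segment of length `L` of the branch `s`, whose links among `x_0, …, x_{m-1}` are those with range
in `W`. -/
noncomputable def extFormula (m L : ℕ) (s : Branch 𝓗) (W : Set (Set (Fin m))) :
    (lang 𝓗).BoundedFormula Empty m :=
  ∃' ((BoundedFormula.iInf fun i : Fin m =>
      ∼((&(Fin.castSucc i) : (lang 𝓗).Term (Empty ⊕ Fin (m + 1))) =' &(Fin.last m))) ⊓
    (atomQ (initial s L) (Fin.last m) ⊓
      BoundedFormula.iInf fun t : {t : Link k → Fin m // Function.Injective t} =>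
        if Set.range t.1 ∈ W then atomR 𝓗 (cons (Fin.last m) (Fin.castSucc ∘ t.1))
        else ∼(atomR 𝓗 (cons (Fin.last m) (Fin.castSucc ∘ t.1)))))

/-- The axiom saying that `extFormula m L s W` holds of all tuples of distinct elements such that
the `i`-th one is on the initial segment of length `L` of the branch `ν i`. -/
noncomputable def extAxiom (m L : ℕ) (s : Branch 𝓗) (ν : Fin m → Branch 𝓗)
    (W : Set (Set (Fin m))) : (lang 𝓗).Sentence :=
  (((BoundedFormula.iInf fun p : {p : Fin m × Fin m // p.1 ≠ p.2} =>
      ∼((&p.1.1 : (lang 𝓗).Term (Empty ⊕ Fin m)) =' &p.1.2)) ⊓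
    BoundedFormula.iInf fun i : Fin m => atomQ (initial (ν i) L) i) ⟹ extFormula m L s W).alls

/-- The extension axioms consistent with `T₀`: below level `L` the prescribed edges must be edges
of the template, above level `L` the extension property of the template takes care of them. -/
inductive ExtAxiom (𝓗 : Template k) : (lang 𝓗).Sentence → Prop
  | mk (m L : ℕ) (s : Branch 𝓗) (ν : Fin m → Branch 𝓗) (W : Set (Set (Fin m)))
      (large : 𝓗.Large L m)
      (compat : ∀ t : Link k → Fin m, Function.Injective t → Set.range t ∈ W →
        ∀ n < L, 𝓗.E n (cons (s n) fun j => ν (t j) n)) : ExtAxiom 𝓗 (extAxiom m L s ν W)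

/-- The theory `T₀` together with the extension axioms. -/
def genericTheory (𝓗 : Template k) : (lang 𝓗).Theory := baseTheory 𝓗 ∪ {φ | ExtAxiom 𝓗 φ}

variable (𝓗 M) in
/-- A semantic form of `genericTheory`. -/
structure IsGeneric : Prop extends IsBaseModel 𝓗 M where
  exists_vertex : ∀ {m L : ℕ} {s : Branch 𝓗} {a : Fin m → M} {W : Set (Set (Fin m))},
    𝓗.Large L m → Function.Injective a →
    (∀ t : Link k → Fin m, Function.Injective t → Set.range t ∈ W →
      ∀ n < L, 𝓗.E n (cons (s n) fun j => branchOf 𝓗 (a (t j)) n)) →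
    ∃ x, (∀ i, a i ≠ x) ∧ (∀ n < L, branchOf 𝓗 x n = s n) ∧
      ∀ t : Link k → Fin m, Function.Injective t → (Edge 𝓗 (cons x (a ∘ t)) ↔ Set.range t ∈ W)

theorem isExistential_extFormula : (extFormula m L s W).IsExistential := by
  refine (BoundedFormula.IsQF.isExistential ?_).ex
  refine (isQF_iInf fun i => ?_).inf (BoundedFormula.IsQF.inf ?_ (isQF_iInf fun t => ?_))
  · exact (BoundedFormula.IsAtomic.equal _ _).isQF.not
  · exact (BoundedFormula.IsAtomic.rel _ _).isQF
  · split_ifs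
    · exact (BoundedFormula.IsAtomic.rel _ _).isQF
    · exact (BoundedFormula.IsAtomic.rel _ _).isQF.not

theorem realize_extFormula : (extFormula m L s W).Realize v a ↔
    ∃ x, (∀ i, a i ≠ x) ∧ Pred (initial s L) x ∧ ∀ t : Link k → Fin m, Function.Injective t →
      (Edge 𝓗 (cons x (a ∘ t)) ↔ Set.range t ∈ W) := by
  simp only [extFormula, BoundedFormula.realize_ex, BoundedFormula.realize_inf,
    BoundedFormula.realize_iInf, BoundedFormula.realize_not, BoundedFormula.realize_bdEqual,
    Function.comp_apply, Term.realize_var, Sum.elim_inr, realize_atomQ, Fin.snoc_last,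
    Fin.snoc_castSucc, Subtype.forall]
  refine exists_congr fun x => and_congr_right fun _ => and_congr_right fun _ =>
    forall_congr' fun t => forall_congr' fun _ => ?_
  have hsnoc : (Fin.snoc a x : Fin (m + 1) → M) ∘ cons (Fin.last m) (Fin.castSucc ∘ t) =
      cons x (a ∘ t) := by
    rw [comp_cons, Fin.snoc_last, ← Function.comp_assoc, Fin.snoc_comp_castSucc]
  split_ifs with hW
  · rw [realize_atomR, hsnoc, iff_true_right hW]
  · rw [BoundedFormula.realize_not, realize_atomR, hsnoc, iff_false_right hW]

theorem realize_extAxiom : Sentence.Realize M (extAxiom m L s ν W) ↔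
    ∀ a : Fin m → M, Function.Injective a → (∀ i, Pred (initial (ν i) L) (a i)) →
      (extFormula m L s W).Realize default a := by
  have inj_iff (a : Fin m → M) :
      Function.Injective a ↔ ∀ i j, i ≠ j → ¬ a i = a j := by
    simp only [Function.Injective, not_imp_not]
  simp only [extAxiom, realize_sentence_alls, BoundedFormula.realize_imp,
    BoundedFormula.realize_inf, BoundedFormula.realize_iInf, BoundedFormula.realize_not,
    BoundedFormula.realize_bdEqual, Function.comp_apply, Term.realize_var, Sum.elim_inr,
    realize_atomQ, Subtype.forall, Prod.forall, inj_iff, and_imp]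

theorem realize_extFormula_of_isGeneric (h : IsGeneric 𝓗 M) (large : 𝓗.Large L m)
    (ha : Function.Injective a) (compat : ∀ t : Link k → Fin m, Function.Injective t →
      Set.range t ∈ W → ∀ n < L, 𝓗.E n (cons (s n) fun j => branchOf 𝓗 (a (t j)) n)) :
    (extFormula m L s W).Realize v a := by
  obtain ⟨x, hx, hs, hW⟩ := h.exists_vertex large ha compat
  exact realize_extFormula.2 ⟨x, hx, h.pred_initial_iff.2 hs, hW⟩

theorem isGeneric_of_realize_extFormula (h : IsBaseModel 𝓗 M)
    (hext : ∀ {m L : ℕ} {s : Branch 𝓗} {a : Fin m → M} {W : Set (Set (Fin m))},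
      𝓗.Large L m → Function.Injective a →
      (∀ t : Link k → Fin m, Function.Injective t → Set.range t ∈ W →
        ∀ n < L, 𝓗.E n (cons (s n) fun j => branchOf 𝓗 (a (t j)) n)) →
      (extFormula m L s W).Realize default a) : IsGeneric 𝓗 M where
  toIsBaseModel := h
  exists_vertex large ha compat := by
    obtain ⟨x, hx, hs, hW⟩ := realize_extFormula.1 (hext large ha compat)
    exact ⟨x, hx, h.pred_initial_iff.1 hs, hW⟩

theorem model_genericTheory_iff : M ⊨ genericTheory 𝓗 ↔ IsGeneric 𝓗 M := by
  constructor
  · intro hM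
    have hb : IsBaseModel 𝓗 M := isBaseModel_of_model (hM.mono Set.subset_union_left)
    refine isGeneric_of_realize_extFormula hb fun large ha compat => ?_
    exact realize_extAxiom.1 ((Theory.model_iff _).1 hM _ (Or.inr (.mk _ _ _ _ _ large compat)))
      _ ha fun i => hb.pred_initial_iff.2 fun _ _ => rfl
  · intro hM
    refine (Theory.model_iff _).2 ?_
    rintro φ (hφ | ⟨m, L, s, ν, W, large, compat⟩)
    · exact (Theory.model_iff _).1 hM.model φ hφ
    · refine realize_extAxiom.2 fun a ha hν => realize_extFormula_of_isGeneric hM large ha ?_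
      intro t ht hW n hn
      simp only [hM.pred_initial_iff.1 (hν _) n hn]
      exact compat t ht hW n hn

theorem IsGeneric.nonempty (h : IsGeneric 𝓗 M) : Nonempty M := by
  obtain ⟨L, hL⟩ := 𝓗.exists_large 0
  obtain ⟨x, -⟩ := h.exists_vertex (s := Classical.arbitrary _) (a := Fin.elim0) (W := ∅) hL
    (Function.injective_of_subsingleton _) fun _ _ h => h.elim
  exact ⟨x⟩

theorem IsGeneric.exists_vertex_finset (h : IsGeneric 𝓗 M) (B : Finset M) (W : Set (Set M))
    (s : Branch 𝓗) (large : 𝓗.Large L B.card)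
    (compat : ∀ w : Link k → M, Function.Injective w → (∀ j, w j ∈ B) → Set.range w ∈ W →
      ∀ n < L, 𝓗.E n (cons (s n) fun j => branchOf 𝓗 (w j) n)) :
    ∃ x ∉ B, (∀ n < L, branchOf 𝓗 x n = s n) ∧ ∀ w : Link k → M, Function.Injective w →
      (∀ j, w j ∈ B) → (Edge 𝓗 (cons x w) ↔ Set.range w ∈ W) := by
  let a : Fin B.card → M := fun i => B.equivFin.symm i
  have ha : Function.Injective a := Subtype.val_injective.comp B.equivFin.symm.injective
  have hrange : ∀ x ∈ B, ∃ i, a i = x := fun x hx => ⟨B.equivFin ⟨x, hx⟩, by simp [a]⟩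
  obtain ⟨x, hx, hs, hW⟩ := h.exists_vertex (s := s) (W := {t | a '' t ∈ W}) large ha
    fun t ht hW => compat (a ∘ t) (ha.comp ht) (fun j => (B.equivFin.symm (t j)).2)
      (by rwa [Set.range_comp])
  refine ⟨x, fun hxB => ?_, hs, fun w hw hwB => ?_⟩
  · obtain ⟨i, hi⟩ := hrange x hxB
    exact hx i hi
  · choose t ht using fun j => hrange (w j) (hwB j)
    obtain rfl : a ∘ t = w := funext ht
    rw [hW t hw.of_comp, Set.range_comp]
    rfl

end

/-! ### Free extensions -/

/-- The elements of `M` together with, freely, new vertices with prescribed branch `s` and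
prescribed links `S` in a finite tuple `a` of elements. -/
inductive FreeExt (𝓗 : Template k) (M : Type w) : Type w
  | base : M → FreeExt 𝓗 M
  | new (s : Branch 𝓗) (m : ℕ) (a : Fin m → FreeExt 𝓗 M) (S : Set (Set (Fin m))) : FreeExt 𝓗 M

namespace FreeExt

section

variable {M : Type w} {s : Branch 𝓗} {m : ℕ} {a : Fin m → FreeExt 𝓗 M} {S : Set (Set (Fin m))}
  {t : Link k → Fin m}

/-- A bound for the stage at which an element is added. -/
def rank : FreeExt 𝓗 M → ℕ
  | base _ => 0
  | new _ _ a _ => (∑ i, rank (a i)) + 1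

/-- The sets of vertices prescribed as the links of an element at its creation. -/
def links : FreeExt 𝓗 M → Set (Set (FreeExt 𝓗 M))
  | base _ => ∅
  | new _ _ a S => (a '' ·) '' S

theorem rank_lt_rank_new (i : Fin m) : (a i).rank < (new s m a S).rank :=
  Nat.lt_succ_of_le (Finset.single_le_sum (f := fun i => (a i).rank) (fun _ _ => Nat.zero_le _)
    (Finset.mem_univ i))

theorem apply_ne_new (i : Fin m) : a i ≠ new s m a S :=
  fun h => (rank_lt_rank_new i).ne (congrArg rank h)

theorem rank_lt_of_mem_links {x y : FreeExt 𝓗 M} {U : Set (FreeExt 𝓗 M)} (hU : U ∈ x.links)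
    (hy : y ∈ U) : y.rank < x.rank := by
  cases x with
  | base x => exact hU.elim
  | new s m a S =>
    obtain ⟨t, -, rfl⟩ := hU
    obtain ⟨i, -, rfl⟩ := hy
    exact rank_lt_rank_new i

theorem range_mem_links_new_iff (ha : Function.Injective a) :
    Set.range (a ∘ t) ∈ (new s m a S).links ↔ Set.range t ∈ S := by
  rw [Set.range_comp]
  exact ha.image_injective.mem_set_image

variable [(lang 𝓗).Structure M]

/-- The branch of an element of the extension. -/
noncomputable def branch : FreeExt 𝓗 M → Branch 𝓗
  | base x => branchOf 𝓗 x
  | new s _ _ _ => s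

/-- The edges of the extension: those of `M`, and those given by a link of one of their entries,
as far as the template permits. -/
def IsEdge (v : Fin k → FreeExt 𝓗 M) : Prop :=
  Function.Injective v ∧ (∀ n, 𝓗.E n fun j => (v j).branch n) ∧
    ((∃ u : Fin k → M, v = base ∘ u ∧ Edge 𝓗 u) ∨ ∃ j, v '' {i | i ≠ j} ∈ (v j).links)

noncomputable instance : (lang 𝓗).Structure (FreeExt 𝓗 M) where
  funMap f := nomatch f
  RelMap {n} r x := match n, r, x with
    | _, Rel.R, v => IsEdge v
    | _, Rel.Q η, x => Through (x 0).branch η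

theorem pred_iff {η : Node 𝓗} {x : FreeExt 𝓗 M} : Pred η x ↔ Through x.branch η := Iff.rfl

theorem branchOf_eq_branch (x : FreeExt 𝓗 M) : branchOf 𝓗 x = x.branch :=
  branchOf_eq fun _ => pred_iff

theorem isBaseModel (hM : IsBaseModel 𝓗 M) : IsBaseModel 𝓗 (FreeExt 𝓗 M) := by
  refine IsBaseModel.of_branches branch (fun _ _ => pred_iff) (fun hv => hv.1) ?_ fun hv => hv.2.1
  rintro v ⟨hinj, hE, hv⟩ σ
  refine ⟨hinj.comp σ.injective, fun n => 𝓗.E_comp_perm (hE n) σ, ?_⟩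
  rcases hv with ⟨u, rfl, hu⟩ | ⟨j, hj⟩
  · exact Or.inl ⟨u ∘ σ, rfl, hM.comp_perm hu σ⟩
  · refine Or.inr ⟨σ.symm j, ?_⟩
    have himage : σ '' {i | i ≠ σ.symm j} = {i | i ≠ j} := by
      ext i
      simp [Equiv.image_eq_preimage_symm]
    rwa [Set.image_comp, himage, Function.comp_apply, Equiv.apply_symm_apply]

theorem isEdge_base_comp_iff (hM : IsBaseModel 𝓗 M) {u : Fin k → M} :
    IsEdge (base ∘ u : Fin k → FreeExt 𝓗 M) ↔ Edge 𝓗 u := by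
  have hbase : Function.Injective (base : M → FreeExt 𝓗 M) := fun _ _ h => by injection h
  constructor
  · rintro ⟨-, -, ⟨u', h, hu'⟩ | ⟨_, hj⟩⟩
    · rwa [hbase.comp_left h]
    · exact hj.elim
  · exact fun hu => ⟨hbase.comp (hM.injective hu), hM.template_edge hu, Or.inl ⟨u, rfl, hu⟩⟩

/-- The inclusion of `M` in its free extension. -/
noncomputable def inclusion (hM : IsBaseModel 𝓗 M) : M ↪[lang 𝓗] FreeExt 𝓗 M :=
  mkEmbedding hM (isBaseModel hM) ⟨base, fun _ _ h => by injection h⟩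
    (fun x => branchOf_eq_branch (base x)) fun _ => isEdge_base_comp_iff hM

theorem range_mem_of_isEdge (ha : Function.Injective a)
    (h : IsEdge (cons (new s m a S) (a ∘ t))) : Set.range t ∈ S := by
  let i₀ : Fin k := ⟨0, 𝓗.k_pos⟩
  obtain ⟨-, -, ⟨u, hu, -⟩ | ⟨j, hj⟩⟩ := h
  · have := congrFun hu i₀
    rw [cons_of_eq_zero _ _ rfl] at this
    cases this
  by_cases hj0 : (j : ℕ) = 0
  · rw [image_cons_ne _ _ hj0, cons_of_eq_zero _ _ hj0] at hj
    exact (range_mem_links_new_iff ha).1 hj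
  · rw [cons_link _ _ ⟨j, hj0⟩] at hj
    have hmem : new s m a S ∈ cons (new s m a S) (a ∘ t) '' {i | i ≠ j} :=
      ⟨i₀, fun h => hj0 (congrArg Fin.val h).symm, cons_of_eq_zero _ _ rfl⟩
    exact absurd (rank_lt_of_mem_links hj hmem) (rank_lt_rank_new _).asymm

theorem isEdge_of_range_mem (ha : Function.Injective a) (ht : Function.Injective t)
    (hE : ∀ n, 𝓗.E n (cons (s n) fun j => (a (t j)).branch n)) (h : Set.range t ∈ S) :
    IsEdge (cons (new s m a S) (a ∘ t)) := by
  refine ⟨injective_cons (ha.comp ht) fun _ => apply_ne_new _, fun n => ?_,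
    Or.inr ⟨⟨0, 𝓗.k_pos⟩, ?_⟩⟩
  · change 𝓗.E n ((fun y => branch y n) ∘ cons (new s m a S) (a ∘ t))
    rw [comp_cons]
    exact hE n
  · rw [image_cons_ne _ _ rfl, cons_of_eq_zero _ _ rfl]
    exact (range_mem_links_new_iff ha).2 h

theorem isGeneric (hM : IsBaseModel 𝓗 M) : IsGeneric 𝓗 (FreeExt 𝓗 M) where
  toIsBaseModel := isBaseModel hM
  exists_vertex {m L s a W} large ha compat := by
    simp only [branchOf_eq_branch] at compat ⊢
    obtain ⟨s', hlt, hge⟩ := Template.Large.exists_branch (ι := Fin m)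
      ((Nat.card_fin m).symm ▸ large) s fun i => (a i).branch
    refine ⟨new s' m a W, apply_ne_new, hlt, fun t ht =>
      ⟨range_mem_of_isEdge ha, fun hW => isEdge_of_range_mem ha ht (fun n => ?_) hW⟩⟩
    rcases lt_or_ge n L with hn | hn
    · exact (hlt n hn).symm ▸ compat t ht hW n hn
    · exact hge n hn t

end

end FreeExt

/-! ### Similar tuples -/

section

variable {M N P ι ι' I : Type*} [(lang 𝓗).Structure M] [(lang 𝓗).Structure N]
  [(lang 𝓗).Structure P] {L L' : ℕ}

variable (𝓗) in
/-- The tuples `a`, `c` satisfy the same equalities and edges, and their entries have the same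
branches below level `L`: an approximation to having the same quantifier-free type. -/
structure Similar (L : ℕ) (a : ι → M) (c : ι → N) : Prop where
  eq_iff : ∀ i j, a i = a j ↔ c i = c j
  branch_eq : ∀ i, ∀ n < L, branchOf 𝓗 (a i) n = branchOf 𝓗 (c i) n
  edge_iff : ∀ v : Fin k → ι, Edge 𝓗 (a ∘ v) ↔ Edge 𝓗 (c ∘ v)

namespace Similar

variable {a : ι → M} {c : ι → N} {e : ι → P} {d : M} {d' : N}

theorem symm (h : Similar 𝓗 L a c) : Similar 𝓗 L c a :=
  ⟨fun i j => (h.eq_iff i j).symm, fun i n hn => (h.branch_eq i n hn).symm,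
    fun v => (h.edge_iff v).symm⟩

theorem trans (h : Similar 𝓗 L a c) (h' : Similar 𝓗 L c e) : Similar 𝓗 L a e :=
  ⟨fun i j => (h.eq_iff i j).trans (h'.eq_iff i j),
    fun i n hn => (h.branch_eq i n hn).trans (h'.branch_eq i n hn),
    fun v => (h.edge_iff v).trans (h'.edge_iff v)⟩

theorem mono (h : Similar 𝓗 L a c) (hL : L' ≤ L) : Similar 𝓗 L' a c :=
  ⟨h.eq_iff, fun i n hn => h.branch_eq i n (hn.trans_le hL), h.edge_iff⟩

theorem comp (h : Similar 𝓗 L a c) (g : ι' → ι) : Similar 𝓗 L (a ∘ g) (c ∘ g) :=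
  ⟨fun i j => h.eq_iff (g i) (g j), fun i => h.branch_eq (g i), fun v => h.edge_iff (g ∘ v)⟩

theorem of_embedding (hM : IsBaseModel 𝓗 M) (g : M ↪[lang 𝓗] N) (L : ℕ) (a : ι → M) :
    Similar 𝓗 L a (g ∘ a) :=
  ⟨fun _ _ => g.injective.eq_iff.symm, fun _ _ _ => congrFun (branchOf_map hM g _).symm _,
    fun v => (map_edge g (v := a ∘ v)).symm⟩

theorem of_subsingleton [Subsingleton ι] (hM : IsBaseModel 𝓗 M) (hN : IsBaseModel 𝓗 N)
    (h : ∀ i, branchOf 𝓗 (a i) = branchOf 𝓗 (c i)) : Similar 𝓗 L a c := by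
  have not_injective (v : Fin k → ι) : ¬ Function.Injective v := fun hv =>
    absurd (hv (Subsingleton.elim (v ⟨0, 𝓗.k_pos⟩) (v ⟨1, 𝓗.two_le⟩))) (by simp)
  exact ⟨fun i j => by rw [Subsingleton.elim i j]; exact iff_of_true rfl rfl,
    fun i n _ => congrFun (h i) n,
    fun v => iff_of_false (fun he => not_injective v (hM.injective he).of_comp)
      fun he => not_injective v (hN.injective he).of_comp⟩

theorem option_elim (hM : IsBaseModel 𝓗 M) (hN : IsBaseModel 𝓗 N) (h : Similar 𝓗 L a c)
    (heq : ∀ l, d = a l ↔ d' = c l) (hbranch : ∀ n < L, branchOf 𝓗 d n = branchOf 𝓗 d' n)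
    (hedge : ∀ u : Link k → ι, Edge 𝓗 (cons d (a ∘ u)) ↔ Edge 𝓗 (cons d' (c ∘ u))) :
    Similar 𝓗 L (fun o : Option ι => o.elim d a) (fun o : Option ι => o.elim d' c) := by
  constructor
  case eq_iff =>
    rintro (_ | i) (_ | j)
    · exact iff_of_true rfl rfl
    · exact heq j
    · exact eq_comm.trans ((heq i).trans eq_comm)
    · exact h.eq_iff i j
  case branch_eq =>
    rintro (_ | i)
    · exact hbranch
    · exact h.branch_eq i
  case edge_iff =>
    intro v
    by_cases hv : Function.Injective v
    swap
    · exact iff_of_false (fun he => hv (hM.injective he).of_comp)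
        fun he => hv (hN.injective he).of_comp
    by_cases hnone : ∃ j, v j = none
    · obtain ⟨j, hj⟩ := hnone
      obtain ⟨σ, u, hσ⟩ := exists_perm_eq_cons_none hv hj
      rw [← hM.edge_comp_perm_iff σ, ← hN.edge_comp_perm_iff σ, Function.comp_assoc,
        Function.comp_assoc, hσ, comp_cons, comp_cons]
      exact hedge u
    · choose u hu using fun j => Option.ne_none_iff_exists'.1 fun hj => hnone ⟨j, hj⟩
      obtain rfl : v = some ∘ u := funext hu
      exact h.edge_iff u

theorem injective_comp_of_edge_cons (h : Similar 𝓗 L a c) (hM : IsBaseModel 𝓗 M)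
    {u : Link k → ι} (he : Edge 𝓗 (cons d (a ∘ u))) : Function.Injective (c ∘ u) := fun _ _ hxy =>
  injective_of_injective_cons (hM.injective he) ((h.eq_iff _ _).2 hxy)

theorem template_edge_of_range_eq (h : Similar 𝓗 L a c) (hM : IsBaseModel 𝓗 M)
    {u : Link k → ι} (he : Edge 𝓗 (cons d (a ∘ u))) {w : Link k → N} (hw : Function.Injective w)
    (hr : Set.range w = Set.range (c ∘ u)) {n : ℕ} (hn : n < L) :
    𝓗.E n (cons (branchOf 𝓗 d n) fun j => branchOf 𝓗 (w j) n) := by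
  obtain ⟨τ, rfl⟩ := exists_perm_of_range_eq hw (h.injective_comp_of_edge_cons hM he) hr
  have hE : 𝓗.E n ((fun x => branchOf 𝓗 x n) ∘ cons d (a ∘ u ∘ τ)) :=
    hM.template_edge ((hM.edge_cons_comp_perm τ).2 he) n
  rw [comp_cons] at hE
  convert hE using 2
  funext j
  exact (h.branch_eq _ n hn).symm

end Similar

/-! ### Amalgamation -/

section

variable {a : ι → M} {c : I → ι → N} {d : M}

theorem edge_cons_of_range_eq (hM : IsBaseModel 𝓗 M) (hc : ∀ i, Similar 𝓗 L a (c i))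
    (coh : Coherent c) {i j : I} {u u' : Link k → ι} (hu : Function.Injective (c i ∘ u))
    (he : Edge 𝓗 (cons d (a ∘ u'))) (hr : Set.range (c i ∘ u) = Set.range (c j ∘ u')) :
    Edge 𝓗 (cons d (a ∘ u)) := by
  obtain ⟨τ, hτ⟩ := exists_perm_of_range_eq hu ((hc j).injective_comp_of_edge_cons hM he) hr
  have : a ∘ u = (a ∘ u') ∘ τ := by
    funext x
    have hx : c i (u x) = c j (u' (τ x)) := congrFun hτ x
    exact ((hc i).eq_iff _ _).2 (hx.trans (coh _ _ _ _ hx).2.symm)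
  rw [this]
  exact (hM.edge_cons_comp_perm τ).2 he

theorem exists_similar_option_notMem [Finite ι] [Finite I] (hM : IsBaseModel 𝓗 M)
    (hN : IsGeneric 𝓗 N) (hc : ∀ i, Similar 𝓗 L a (c i)) (coh : Coherent c) (hd : ∀ l, d ≠ a l)
    (D : Finset N) (hL : 𝓗.Large L (D.card + Nat.card I * Nat.card ι)) :
    ∃ d' ∉ D, ∀ i,
      Similar 𝓗 L (fun o : Option ι => o.elim d a) (fun o : Option ι => o.elim d' (c i)) := by
  classical
  have := Fintype.ofFinite (I × ι)
  let B : Finset N := D ∪ Finset.univ.image fun p : I × ι => c p.1 p.2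
  have hcB (i l) : c i l ∈ B :=
    Finset.mem_union_right _ (Finset.mem_image.2 ⟨(i, l), Finset.mem_univ _, rfl⟩)
  have hB : B.card ≤ D.card + Nat.card I * Nat.card ι := by
    refine (Finset.card_union_le _ _).trans (Nat.add_le_add_left ?_ _)
    rw [← Nat.card_prod, Nat.card_eq_fintype_card]
    exact Finset.card_image_le
  obtain ⟨d', hd'B, hbranch, hlinks⟩ := hN.exists_vertex_finset B
    {U | ∃ (i : I) (u : Link k → ι), U = Set.range (c i ∘ u) ∧ Edge 𝓗 (cons d (a ∘ u))}
    (branchOf 𝓗 d) (hL.mono le_rfl hB) <| by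
      rintro w hw - ⟨i, u, hr, he⟩ n hn
      exact (hc i).template_edge_of_range_eq hM he hw hr hn
  refine ⟨d', fun h => hd'B (Finset.mem_union_left _ h), fun i =>
    (hc i).option_elim hM hN.toIsBaseModel
      (fun l => iff_of_false (hd l) fun h => hd'B (h ▸ hcB i l))
      (fun n hn => (hbranch n hn).symm) fun u => ?_⟩
  by_cases hu : Function.Injective (c i ∘ u)
  · rw [hlinks _ hu fun _ => hcB _ _]
    exact ⟨fun he => ⟨i, u, rfl, he⟩,
      fun ⟨_, _, hr, he⟩ => edge_cons_of_range_eq hM hc coh hu he hr⟩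
  · exact iff_of_false (fun he => hu ((hc i).injective_comp_of_edge_cons hM he))
      fun he => hu (injective_of_injective_cons (hN.injective he))

theorem exists_similar_option [Finite ι] [Finite I] (hM : IsBaseModel 𝓗 M) (hN : IsGeneric 𝓗 N)
    (hc : ∀ i, Similar 𝓗 L a (c i)) (coh : Coherent c) (hd : ∀ l, d = a l → ∀ i j, c i l = c j l)
    (hL : 𝓗.Large L (Nat.card I * Nat.card ι)) : ∃ d' : N, ∀ i,
      Similar 𝓗 L (fun o : Option ι => o.elim d a) (fun o : Option ι => o.elim d' (c i)) := by
  by_cases hda : ∃ l, d = a l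
  · obtain ⟨l, rfl⟩ := hda
    rcases isEmpty_or_nonempty I with hI | ⟨⟨i₀⟩⟩
    · exact ⟨hN.nonempty.some, isEmptyElim⟩
    refine ⟨c i₀ l, fun i => ?_⟩
    rw [hd l rfl i₀ i]
    convert (hc i).comp (fun o : Option ι => o.elim l id) using 1 <;> funext o <;> cases o <;> rfl
  · obtain ⟨d', -, hd'⟩ := exists_similar_option_notMem hM hN hc coh
      (fun l h => hda ⟨l, h⟩) ∅ (by rwa [Finset.card_empty, zero_add])
    exact ⟨d', hd'⟩

theorem coherent_option {d' : N} (coh : Coherent c)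
    (h : ∀ i, Similar 𝓗 L (fun o : Option ι => o.elim d a) (fun o : Option ι => o.elim d' (c i))) :
    Coherent fun i (o : Option ι) => o.elim d' (c i) := by
  have transfer {i j l} (hl : d' = c i l) : d' = c j l :=
    ((h j).eq_iff none (some l)).1 (((h i).eq_iff none (some l)).2 hl)
  rintro i j (_ | l) (_ | l') hll'
  · exact ⟨rfl, rfl⟩
  · exact ⟨rfl, (transfer hll').symm.trans hll'⟩
  · exact ⟨hll'.trans (transfer hll'.symm), rfl⟩
  · exact coh i j l l' hll'

theorem exists_similar_sum [Finite ι] [Finite I] (hM : IsBaseModel 𝓗 M) (hN : IsGeneric 𝓗 N)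
    {m : ℕ} {b : Fin m → M} (hc : ∀ i, Similar 𝓗 L a (c i)) (coh : Coherent c)
    (hb : ∀ t l, b t = a l → ∀ i j, c i l = c j l)
    (hL : 𝓗.Large L (Nat.card I * (Nat.card ι + m))) :
    ∃ b' : Fin m → N, ∀ i, Similar 𝓗 L (Sum.elim b a) (Sum.elim b' (c i)) := by
  induction m generalizing ι with
  | zero =>
    refine ⟨Fin.elim0, fun i => ?_⟩
    convert (hc i).comp (Sum.elim Fin.elim0 id) using 1 <;>
    · funext x
      exact Sum.casesOn x (fun x => x.elim0) fun _ => rfl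
  | succ m ih =>
    obtain ⟨d, hd⟩ := exists_similar_option hM hN hc coh (hb 0)
      (hL.mono le_rfl (Nat.mul_le_mul_left _ (Nat.le_add_right _ _)))
    have hb' : ∀ t (o : Option ι), b (Fin.succ t) = o.elim (b 0) a →
        ∀ i j, o.elim d (c i) = o.elim d (c j) := by
      rintro t (_ | l) h i j
      · rfl
      · exact hb t.succ l h i j
    obtain ⟨b', hsim⟩ := ih hd (coherent_option coh hd) hb'
      (hL.mono le_rfl (by rw [Finite.card_option, add_assoc, add_comm 1]))
    refine ⟨Fin.cons d b', fun i => ?_⟩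
    convert (hsim i).comp (Sum.elim (Fin.cons (Sum.inr none) Sum.inl) (Sum.inr ∘ some)) using 1 <;>
    · funext x
      rcases x with x | x
      · refine Fin.cases ?_ (fun x => ?_) x <;> simp
      · rfl

end

end

/-! ### Formulas in generic models -/

theorem exists_eq_var {β : Type*} (t : (lang 𝓗).Term β) : ∃ x, t = Term.var x := by
  cases t with
  | var x => exact ⟨x, rfl⟩
  | func f _ => exact nomatch f

section

variable {α : Type*} {n L L' : ℕ}

/-- The bounded formula `φ` cannot distinguish tuples of generic models that are similar at level
`L`: a semantic form of quantifier elimination, which only lets the predicates `Q_η` with `η` of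
length at most `L` occur. -/
def DeterminedAt (L : ℕ) (φ : (lang 𝓗).BoundedFormula α n) : Prop :=
  ∀ ⦃M N : Type w⦄ [(lang 𝓗).Structure M] [(lang 𝓗).Structure N], IsGeneric 𝓗 M → IsGeneric 𝓗 N →
    ∀ ⦃v : α → M⦄ ⦃xs : Fin n → M⦄ ⦃v' : α → N⦄ ⦃xs' : Fin n → N⦄,
      Similar 𝓗 L (Sum.elim v xs) (Sum.elim v' xs') → (φ.Realize v xs ↔ φ.Realize v' xs')

namespace DeterminedAt

variable {φ ψ : (lang 𝓗).BoundedFormula α n}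

theorem mono (h : DeterminedAt.{w} L φ) (hL : L ≤ L') : DeterminedAt.{w} L' φ :=
  fun _ _ _ _ hM hN _ _ _ _ hsim => h hM hN (hsim.mono hL)

theorem imp (hφ : DeterminedAt.{w} L φ) (hψ : DeterminedAt.{w} L ψ) :
    DeterminedAt.{w} L (φ.imp ψ) := fun _ _ _ _ hM hN _ _ _ _ hsim => by
  rw [BoundedFormula.realize_imp, BoundedFormula.realize_imp, hφ hM hN hsim, hψ hM hN hsim]

theorem all [Finite α] {φ : (lang 𝓗).BoundedFormula α (n + 1)} (hφ : DeterminedAt.{w} L φ)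
    (hL : 𝓗.Large L (Nat.card (α ⊕ Fin n))) : DeterminedAt.{w} L φ.all := by
  suffices transfer : ∀ {M N : Type w} [(lang 𝓗).Structure M] [(lang 𝓗).Structure N],
      IsGeneric 𝓗 M → IsGeneric 𝓗 N →
      ∀ {v : α → M} {xs : Fin n → M} {v' : α → N} {xs' : Fin n → N},
        Similar 𝓗 L (Sum.elim v xs) (Sum.elim v' xs') → φ.all.Realize v xs →
          φ.all.Realize v' xs' from
    fun _ _ _ _ hM hN _ _ _ _ hsim => ⟨transfer hM hN hsim, transfer hN hM hsim.symm⟩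
  intro M N _ _ hM hN v xs v' xs' hsim hall y
  obtain ⟨x, hx⟩ := exists_similar_option (I := Unit) (d := y) hN.toIsBaseModel hM
    (fun _ => hsim.symm) (coherent_of_subsingleton _) (fun _ _ _ _ => rfl)
    (by rwa [Nat.card_unique, one_mul])
  refine (hφ hM hN ?_).1 (hall x)
  convert (hx ()).symm.comp (Sum.elim (some ∘ Sum.inl)
    (Fin.snoc (α := fun _ => Option (α ⊕ Fin n)) (some ∘ Sum.inr) none)) using 1 <;>
  · funext z
    rcases z with z | z
    · rfl
    · refine Fin.lastCases ?_ (fun z => ?_) z <;> simp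

end DeterminedAt

theorem exists_determinedAt_rel {l : ℕ} (r : (lang 𝓗).Relations l) (x : Fin l → α ⊕ Fin n) :
    ∃ L, DeterminedAt.{w} L (r.boundedFormula fun i => Term.var (x i)) := by
  cases r with
  | R => exact ⟨0, fun _ _ _ _ _ _ _ _ _ _ h => h.edge_iff x⟩
  | Q η =>
    refine ⟨η.lgn, fun M N _ _ hM hN v xs v' xs' h => ?_⟩
    refine (relMap_symQ _).trans (Iff.trans ?_ (relMap_symQ _).symm)
    rw [hM.pred_iff, hN.pred_iff]
    exact forall_congr' fun i => by
      simp only [Term.realize_var]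
      rw [h.branch_eq _ i i.2]

theorem exists_determinedAt [Finite α] (φ : (lang 𝓗).BoundedFormula α n) :
    ∃ L, DeterminedAt.{w} L φ := by
  induction φ with
  | falsum => exact ⟨0, fun _ _ _ _ _ _ _ _ _ _ _ => Iff.rfl⟩
  | equal t₁ t₂ =>
    obtain ⟨x, rfl⟩ := exists_eq_var t₁
    obtain ⟨y, rfl⟩ := exists_eq_var t₂
    exact ⟨0, fun _ _ _ _ _ _ _ _ _ _ h => h.eq_iff x y⟩
  | rel r ts =>
    choose x hx using fun i => exists_eq_var (ts i)
    obtain rfl := funext hx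
    exact exists_determinedAt_rel r x
  | imp φ ψ ihφ ihψ =>
    obtain ⟨L₁, h₁⟩ := ihφ
    obtain ⟨L₂, h₂⟩ := ihψ
    exact ⟨max L₁ L₂, (h₁.mono (le_max_left _ _)).imp (h₂.mono (le_max_right _ _))⟩
  | @all n φ ih =>
    obtain ⟨L₁, h₁⟩ := ih
    obtain ⟨L₂, h₂⟩ := 𝓗.exists_large (Nat.card (α ⊕ Fin n))
    exact ⟨max L₁ L₂, (h₁.mono (le_max_left _ _)).all (h₂.mono (le_max_right _ _) le_rfl)⟩

theorem exists_level [Finite α] (φ : (lang 𝓗).Formula α) :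
    ∃ L, ∀ ⦃M N : Type w⦄ [(lang 𝓗).Structure M] [(lang 𝓗).Structure N],
      IsGeneric 𝓗 M → IsGeneric 𝓗 N → ∀ ⦃v : α → M⦄ ⦃v' : α → N⦄,
        Similar 𝓗 L v v' → (φ.Realize v ↔ φ.Realize v') := by
  obtain ⟨L, hL⟩ := exists_determinedAt φ
  refine ⟨L, fun M N _ _ hM hN v v' h => hL hM hN ?_⟩
  convert h.comp (Sum.elim id Fin.elim0) using 1 <;>
  · funext z
    exact Sum.casesOn z (fun _ => rfl) fun z => z.elim0

end

/-! ### The model completion -/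

/-- An embedding between generic models, as an elementary embedding. -/
def toElementary {M N : Type w} [(lang 𝓗).Structure M] [(lang 𝓗).Structure N]
    (hM : IsGeneric 𝓗 M) (hN : IsGeneric 𝓗 N) (g : M ↪[lang 𝓗] N) : M ↪ₑ[lang 𝓗] N where
  toFun := g
  map_formula' _ φ x := by
    obtain ⟨L, hL⟩ := exists_level φ
    exact (hL hM hN (.of_embedding hM.toIsBaseModel g L x)).symm

theorem IsGeneric.of_elementaryEmbedding {M N : Type*} [(lang 𝓗).Structure M]
    [(lang 𝓗).Structure N] (hM : IsGeneric 𝓗 M) (f : M ↪ₑ[lang 𝓗] N) : IsGeneric 𝓗 N :=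
  model_genericTheory_iff.1 ((f.theory_model_iff _).1 (model_genericTheory_iff.2 hM))

theorem realize_iff_of_embeddings {M N₁ N₂ : Type w} [(lang 𝓗).Structure M]
    [(lang 𝓗).Structure N₁] [(lang 𝓗).Structure N₂] (hM : IsBaseModel 𝓗 M)
    (h₁ : IsGeneric 𝓗 N₁) (h₂ : IsGeneric 𝓗 N₂) (f₁ : M ↪[lang 𝓗] N₁) (f₂ : M ↪[lang 𝓗] N₂)
    (φ : (lang 𝓗).Formula M) : φ.Realize f₁ ↔ φ.Realize f₂ := by
  classical
  obtain ⟨L, hL⟩ := exists_level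
    (BoundedFormula.restrictFreeVar φ (id : φ.freeVarFinset → φ.freeVarFinset))
  have h_restrict := hL h₁ h₂ (v := f₁ ∘ (↑)) (v' := f₂ ∘ (↑))
    ((Similar.of_embedding hM f₁ L _).symm.trans (Similar.of_embedding hM f₂ L _))
  unfold Formula.Realize at h_restrict ⊢
  exact (BoundedFormula.realize_restrictFreeVar (f := id) f₁ fun _ => rfl).symm.trans
    (h_restrict.trans (BoundedFormula.realize_restrictFreeVar (f := id) f₂ fun _ => rfl))

theorem isModelCompletion_genericTheory (𝓗 : Template k) :
    IsModelCompletion (baseTheory 𝓗) (genericTheory 𝓗) where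
  extends_base φ hφ := Theory.models_sentence_of_mem (Or.inl hφ)
  embeds M := by
    have hM := isBaseModel_of_model M.is_model
    have := model_genericTheory_iff.2 (FreeExt.isGeneric hM)
    have := (FreeExt.isGeneric hM).nonempty
    exact ⟨⟨FreeExt 𝓗 M⟩, ⟨FreeExt.inclusion hM⟩⟩
  diagram_complete M N₁ N₂ f₁ f₂ φ := realize_iff_of_embeddings (isBaseModel_of_model M.is_model)
    (model_genericTheory_iff.1 N₁.is_model) (model_genericTheory_iff.1 N₂.is_model) f₁ f₂ φ

section

variable {T : (lang 𝓗).Theory}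

theorem isGeneric_of_isModelCompletion (hT : IsModelCompletion (baseTheory 𝓗) T)
    (M : Theory.ModelType.{0, 0, 0} T) : IsGeneric 𝓗 M := by
  have hM : IsBaseModel 𝓗 M := isBaseModel_of_model (hT.model_base M)
  refine isGeneric_of_realize_extFormula hM fun {_ _ _ a _} large ha compat => ?_
  have hE := FreeExt.isGeneric hM
  refine hT.realize_of_isExistential M hE.model (FreeExt.inclusion hM) isExistential_extFormula
    (realize_extFormula_of_isGeneric hE large ((FreeExt.inclusion hM).injective.comp ha) ?_)
  simpa only [Function.comp_apply, branchOf_map hM] using compat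

theorem nonempty_model_of_isModelCompletion (hT : IsModelCompletion (baseTheory 𝓗) T) :
    Nonempty (Theory.ModelType.{0, 0, 0} T) := by
  let _ : (lang 𝓗).Structure Empty := ⟨fun f => (nomatch f), fun _ _ => False⟩
  have h_empty : IsBaseModel 𝓗 Empty :=
    ⟨fun h => h.elim, fun h => h.elim, fun h => h.elim, fun {_ x} => x.elim⟩
  have hE := FreeExt.isGeneric h_empty
  have := hE.model
  have := hE.nonempty
  obtain ⟨N, -⟩ := hT.embeds ⟨FreeExt 𝓗 Empty⟩
  exact ⟨N⟩

end

/-! ### Consistency of instances -/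

section

open Filter

variable {M N ι : Type*} [(lang 𝓗).Structure M] [(lang 𝓗).Structure N]

theorem Similar.of_realize_iff (hM : IsBaseModel 𝓗 M) (hN : IsBaseModel 𝓗 N) {a : ι → M}
    {c : ι → N} (h : ∀ φ : (lang 𝓗).Formula ι, φ.Realize a ↔ φ.Realize c) (L : ℕ) :
    Similar 𝓗 L a c := by
  constructor
  case eq_iff =>
    intro i j
    have := h (Term.equal (Term.var i) (Term.var j))
    rwa [Formula.realize_equal, Formula.realize_equal] at this
  case branch_eq =>
    intro i n hn
    have := h ((symQ (initial (branchOf 𝓗 (a i)) L)).formula fun _ => Term.var i)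
    rw [Formula.realize_rel, Formula.realize_rel, relMap_symQ, relMap_symQ] at this
    exact (hN.pred_initial_iff.1 (this.1 (hM.pred_initial_iff.2 fun _ _ => rfl)) n hn).symm
  case edge_iff =>
    intro v
    have := h ((symR 𝓗).formula fun j => Term.var (v j))
    rwa [Formula.realize_rel, Formula.realize_rel] at this

theorem eventually_eventually_similar [Finite ι] (s : ℕ → ι → N) (L : ℕ) :
    ∀ᶠ i in hyperfilter ℕ, ∀ᶠ j in hyperfilter ℕ, Similar 𝓗 L (s i) (s j) := by
  let data (i : ℕ) : (ι → ι → Prop) × (ι → ∀ n : Fin L, Fin (𝓗.H n)) × ((Fin k → ι) → Prop) :=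
    (fun l l' => s i l = s i l', fun l n => branchOf 𝓗 (s i l) n, fun v => Edge 𝓗 (s i ∘ v))
  have of_data_eq {i j : ℕ} (h : data i = data j) : Similar 𝓗 L (s i) (s j) := by
    simp only [data, Prod.mk.injEq] at h
    exact ⟨fun l l' => iff_of_eq (congrFun (congrFun h.1 l) l'),
      fun l n hn => congrFun (congrFun h.2.1 l) ⟨n, hn⟩, fun v => iff_of_eq (congrFun h.2.2 v)⟩
  filter_upwards [eventually_eventually_eq_of_eventuallyConst
    (eventuallyConst_of_finite (hyperfilter ℕ) data)] with i hi
  exact hi.mono fun j hij => of_data_eq hij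

end

section

open Filter

variable {M N : Type w} [(lang 𝓗).Structure M] [(lang 𝓗).Structure N] {m n : ℕ}

theorem exists_level_amalgam (φ : (lang 𝓗).Formula (Fin m ⊕ Fin n)) (I : Type*) [Finite I] :
    ∃ L, ∀ ⦃M N : Type w⦄ [(lang 𝓗).Structure M] [(lang 𝓗).Structure N], IsGeneric 𝓗 M →
      IsGeneric 𝓗 N → ∀ ⦃b : Fin m → M⦄ ⦃a : Fin n → M⦄ ⦃c : I → Fin n → N⦄,
        φ.Realize (Sum.elim b a) → (∀ i, Similar 𝓗 L a (c i)) → Coherent c →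
        (∀ t l, b t = a l → ∀ i j, c i l = c j l) →
        ∃ b' : Fin m → N, ∀ i, φ.Realize (Sum.elim b' (c i)) := by
  obtain ⟨L₁, h₁⟩ := exists_level φ
  obtain ⟨L₂, h₂⟩ := 𝓗.exists_large (Nat.card I * (n + m))
  refine ⟨max L₁ L₂, fun M N _ _ hM hN b a c hφ hc coh hb => ?_⟩
  obtain ⟨b', hb'⟩ := exists_similar_sum hM.toIsBaseModel hN hc coh hb
    (h₂.mono (le_max_right _ _) (by rw [Nat.card_fin]))
  exact ⟨b', fun i => (h₁ hM hN ((hb' i).mono (le_max_left _ _))).1 hφ⟩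

theorem exists_realize_of_isIndiscernible (hM : IsGeneric 𝓗 M)
    (φ : (lang 𝓗).Formula (Fin m ⊕ Fin n)) {I : Type*} [LinearOrder I] [Infinite I]
    {a : I → Fin n → M} (ha : IsIndiscernible (lang 𝓗) a) {i₀ : I} {b : Fin m → M}
    (hb : ∀ t l, b t ≠ a i₀ l) (hφ : φ.Realize (Sum.elim b (a i₀))) (S : Finset I) :
    ∃ b' : Fin m → M, ∀ i ∈ S, φ.Realize (Sum.elim b' (a i)) := by
  obtain ⟨L, hL⟩ := exists_level_amalgam φ S
  obtain ⟨b', hb'⟩ := hL hM hM (c := fun i => a i) hφ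
    (fun i => .of_realize_iff hM.toIsBaseModel hM.toIsBaseModel (ha.realize_iff · i₀ i) L)
    (ha.coherent.comp _) fun t l h => absurd h (hb t l)
  exact ⟨b', fun i hi => hb' ⟨i, hi⟩⟩

theorem exists_level_finset (φ : (lang 𝓗).Formula (Fin m ⊕ Fin n)) (r : ℕ) :
    ∃ L, ∀ ⦃M N : Type w⦄ [(lang 𝓗).Structure M] [(lang 𝓗).Structure N], IsGeneric 𝓗 M →
      IsGeneric 𝓗 N → ∀ ⦃b : Fin m → M⦄ ⦃a : Fin n → M⦄ ⦃s : ℕ → Fin n → N⦄,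
        φ.Realize (Sum.elim b a) → (∀ᶠ i in hyperfilter ℕ, Similar 𝓗 L a (s i)) →
        (∀ t l, b t = a l → EventuallyConst (s · l) (hyperfilter ℕ)) →
        ∃ S : Finset ℕ, S.card = r ∧ ∃ b' : Fin m → N, ∀ i ∈ S, φ.Realize (Sum.elim b' (s i)) := by
  obtain ⟨L, hL⟩ := exists_level_amalgam φ (Fin r)
  refine ⟨L, fun M N _ _ hM hN b a s hφ hs hb => ?_⟩
  obtain ⟨f, hf, hsim, coh, hconst⟩ := exists_coherent_subsequence s hs
  obtain ⟨b', hb'⟩ := hL hM hN (c := fun i : Fin r => s (f i)) hφ (fun i => hsim i)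
    (coh.comp fun i : Fin r => (i : ℕ)) fun t l h i j => hconst l (hb t l h) i j
  exact ⟨Finset.univ.map ⟨fun i : Fin r => f i, hf.comp Fin.val_injective⟩, by simp, b',
    by simpa using hb'⟩

theorem not_divides (hM : IsGeneric 𝓗 M) (φ : (lang 𝓗).Formula (Fin m ⊕ Fin n)) (A : Set M)
    {a : Fin n → M} {b : Fin m → M} (hb : ∀ t l, b t ≠ a l) (hφ : φ.Realize (Sum.elim b a)) :
    ¬ Divides A φ a := by
  rintro ⟨N, _, f, r, s, hs, hincon⟩
  have hN : IsGeneric 𝓗 N := hM.of_elementaryEmbedding f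
  obtain ⟨L, hL⟩ := exists_level_finset φ r
  have hsim (i : ℕ) : Similar 𝓗 L a (s i) :=
    .of_realize_iff hM.toIsBaseModel hN.toIsBaseModel
      (fun ψ => (f.map_formula ψ a).symm.trans ((hs i).realize_iff ψ).symm) L
  obtain ⟨S, hS, hcon⟩ := hL hM hN hφ (Eventually.of_forall hsim) fun t l h => absurd h (hb t l)
  exact hincon S hS hcon

/-! ### Simplicity -/

theorem eventually_exists_apply_eq (hN : IsGeneric 𝓗 N) (φ : (lang 𝓗).Formula (Fin m ⊕ Fin n))
    {r : ℕ} {s : ℕ → Fin n → N} (hincon : ∀ S : Finset ℕ, S.card = r →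
      ¬ ∃ b : Fin m → N, ∀ i ∈ S, φ.Realize (Sum.elim b (s i))) :
    ∀ᶠ i in hyperfilter ℕ, ∀ b : Fin m → N, φ.Realize (Sum.elim b (s i)) →
      ∃ t l, ¬ EventuallyConst (s · l) (hyperfilter ℕ) ∧ b t = s i l := by
  obtain ⟨L, hL⟩ := exists_level_finset φ r
  filter_upwards [eventually_eventually_similar (𝓗 := 𝓗) s L] with i hi b hb
  by_contra! hmeet
  obtain ⟨S, hS, hcon⟩ := hL hN hN hb hi fun t l h => by_contra fun hl => hmeet t l hl h
  exact hincon S hS hcon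

theorem not_hasTreeProperty (hM : IsGeneric 𝓗 M) (φ : (lang 𝓗).Formula (Fin m ⊕ Fin n)) :
    ¬ HasTreeProperty M φ := by
  rintro ⟨r, a, hbranch, hchild⟩
  obtain ⟨σ, hσ⟩ := exists_branch_forall_ne a fun η =>
    eventually_exists_apply_eq hM φ (hchild η)
  let p (j : ℕ) : List ℕ := List.ofFn fun i : Fin j => σ i
  have p_succ (j : ℕ) : p (j + 1) = p j ++ [σ j] := by
    simp only [p, List.ofFn_succ', List.concat_eq_append, Fin.val_castSucc, Fin.val_last]
  obtain ⟨b, hb⟩ := hbranch σ (Finset.range (m + 2))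
  have hmeet (j : Fin (m + 1)) : ∃ t l,
      ¬ EventuallyConst (fun i => a (p j ++ [i]) l) (hyperfilter ℕ) ∧ b t = a (p (j + 1)) l := by
    rw [p_succ]
    refine (hσ j).1 b ?_
    rw [← p_succ]
    exact hb (j + 1) (Finset.mem_range.2 (by lia))
  choose t l hl hbt using hmeet
  have t_ne {j j' : Fin (m + 1)} (hlt : j < j') : t j ≠ t j' := fun ht =>
    (hσ j').2 (j + 1) hlt (l j') (l j) (hl j') <| by rw [← hbt, ← hbt, ht]
  obtain ⟨j, j', hne, ht⟩ := Fintype.exists_ne_map_eq_of_card_lt t (by simp)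
  exact hne.lt_or_gt.elim (fun h => t_ne h ht) fun h => t_ne h ht.symm

/-! ### Rank -/

theorem exists_realize_notMem (hM : IsGeneric 𝓗 M) (hN : IsGeneric 𝓗 N) (f : M ↪[lang 𝓗] N)
    {φ : (lang 𝓗).Formula (Fin 1 ⊕ Fin n)} {a : Fin n → M} {b : Fin 1 → M}
    (hb : ∀ l, b 0 ≠ a l) (hφ : φ.Realize (Sum.elim b a)) (D : Finset N) :
    ∃ d ∉ D, φ.Realize (Sum.elim (fun _ => d) (f ∘ a)) := by
  obtain ⟨L₁, h₁⟩ := exists_level φ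
  obtain ⟨L₂, h₂⟩ := 𝓗.exists_large (D.card + n)
  obtain ⟨d, hdD, hd⟩ := exists_similar_option_notMem (I := Unit) hM.toIsBaseModel hN
    (fun _ => Similar.of_embedding hM.toIsBaseModel f (max L₁ L₂) a) (coherent_of_subsingleton _)
    hb D (h₂.mono (le_max_right _ _) (by rw [Nat.card_unique, one_mul, Nat.card_fin]))
  refine ⟨d, hdD, (h₁ hM hN (v := Sum.elim b a) ?_).1 hφ⟩
  convert ((hd ()).mono (le_max_left _ _)).comp (Sum.elim (fun _ => none) some) using 1 <;>
  · funext z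
    rcases z with z | z
    · rw [Subsingleton.elim z 0]
      rfl
    · rfl

theorem not_typeForks_of_notMem (hM : IsGeneric 𝓗 M) {A B : Set M} {b : Fin 1 → M}
    (hb : b 0 ∉ B) : ¬ TypeForks (lang 𝓗) A B b := by
  classical
  rintro ⟨n, φ, a, haB, hφ, N, _, f, l, p, ψ, c, hdiv, himp⟩
  have hN : IsGeneric 𝓗 N := hM.of_elementaryEmbedding f
  let D : Finset N := Finset.univ.biUnion fun i => Finset.univ.image (c i)
  have hba (l : Fin n) : b 0 ≠ a l := fun h => hb (h ▸ haB l)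
  obtain ⟨d, hdD, hd⟩ := exists_realize_notMem hM hN f.toEmbedding hba hφ D
  obtain ⟨i, hi⟩ := himp _ hd
  refine not_divides hN (ψ i) _ (fun _ l hl => hdD ?_) hi (hdiv i)
  rw [hl]
  exact Finset.mem_biUnion.2
    ⟨i, Finset.mem_univ _, Finset.mem_image_of_mem _ (Finset.mem_univ _)⟩

theorem not_suRankGE_two (hM : IsGeneric 𝓗 M) (A : Set M) (b : Fin 1 → M) :
    ¬ SURankGE (lang 𝓗) 2 M A b := by
  rintro ⟨N, _, f, B, -, hforks, N', _, g, B', -, hforks', -⟩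
  by_cases hb : f (b 0) ∈ B
  · refine not_typeForks_of_mem (fun j => ?_) hforks'
    rw [Subsingleton.elim j 0]
    exact Set.mem_image_of_mem g hb
  · have hN : IsGeneric 𝓗 N :=
      model_genericTheory_iff.1 ((f.theory_model_iff _).1 (model_genericTheory_iff.2 hM))
    exact not_typeForks_of_notMem hN hb hforks

theorem suRankGE_one (hM : IsGeneric 𝓗 M) (b : Fin 1 → M) : SURankGE (lang 𝓗) 1 M ∅ b := by
  have hMb := hM.toIsBaseModel
  have hE := FreeExt.isGeneric hMb
  let s (i : ℕ) (_ : Fin 1) : FreeExt 𝓗 M :=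
    .new (branchOf 𝓗 (b 0)) i (fun _ => FreeExt.base (b 0)) ∅
  have hs (i : ℕ) (φ : (lang 𝓗).Formula (Fin 1)) :
      φ.Realize (s i) ↔ φ.Realize (FreeExt.inclusion hMb ∘ b) := by
    obtain ⟨L, hL⟩ := exists_level φ
    refine hL hE hE (.of_subsingleton hE.toIsBaseModel hE.toIsBaseModel fun j => ?_)
    rw [Function.comp_apply, branchOf_map hMb, Subsingleton.elim j 0]
    exact FreeExt.branchOf_eq_branch _
  have hinj : Function.Injective s := fun i j hij => by
    injection congrFun hij 0
  refine suRankGE_one_of_divides (divides_equal (toElementary hM hE (FreeExt.inclusion hMb))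
    (a := b) (s := s) (fun i => ?_) hinj) rfl
  rw [Set.image_empty]
  exact sameTypeOver_empty (hs i)

end

end HypergraphTemplate

theorem mainTheorem7 {k : ℕ} (𝓗 : HypergraphTemplate.Template k) :
    (∃ T : (HypergraphTemplate.lang 𝓗).Theory,
      ModelNotions.IsModelCompletion (HypergraphTemplate.baseTheory 𝓗) T) ∧
    ∀ T : (HypergraphTemplate.lang 𝓗).Theory,
      ModelNotions.IsModelCompletion (HypergraphTemplate.baseTheory 𝓗) T →
      ModelNotions.IsSimpleTheory T ∧
      ModelNotions.HasRankOne T ∧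
      ∀ (M : Theory.ModelType.{0, 0, 0} T) (m n : ℕ)
        (φ : (HypergraphTemplate.lang 𝓗).Formula (Fin m ⊕ Fin n)),
        (∀ (I : Type) [LinearOrder I] [Infinite I] (a : I → Fin n → M),
          ModelNotions.IsIndiscernible (HypergraphTemplate.lang 𝓗) a →
          ∀ (i₀ : I) (b : Fin m → M), (∀ j l, b j ≠ a i₀ l) →
            φ.Realize (Sum.elim b (a i₀)) →
            ∀ S : Finset I, ∃ b' : Fin m → M, ∀ i ∈ S, φ.Realize (Sum.elim b' (a i))) ∧
        ∀ (A : Set M) (a : Fin n → M) (b : Fin m → M), (∀ j l, b j ≠ a l) →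
          φ.Realize (Sum.elim b a) → ¬ ModelNotions.Divides A φ a := by
  open HypergraphTemplate in
  refine ⟨⟨_, isModelCompletion_genericTheory 𝓗⟩, fun T hT => ?_⟩
  have generic := isGeneric_of_isModelCompletion hT
  refine ⟨fun M m n φ => not_hasTreeProperty (generic M) φ,
    ⟨?_, fun M => not_suRankGE_two (generic M)⟩, fun M m n φ =>
      ⟨fun I _ _ a ha i₀ b hb hφ => exists_realize_of_isIndiscernible (generic M) φ ha hb hφ,
        fun A a b hb hφ => not_divides (generic M) φ A hb hφ⟩⟩
  obtain ⟨M⟩ := nonempty_model_of_isModelCompletion hT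
  exact ⟨M, ∅, fun _ => M.nonempty'.some, suRankGE_one (generic M) _⟩
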